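/- **Setting.** Time is $t=0,1,2,\dots$. Each date has one young and one old agent. The endowment share of the young takes values $0<s(1)<\dots<s(I)<1$, $I\ge 2$, with probabilities $\pi(i)>0$; the gross growth rate of the aggregate endowment takes finitely many values $\gamma>0$ with probabilities $\varsigma(\gamma)>0$. Shocks are i.i.d. over time, and shares and growth rates are independent. Let $\bar\gamma=(\sum_\gamma\varsigma(\gamma)/\gamma)^{-1}$. Utility is logarithmic, with generational discount factor $\beta\in(0,1]$ and planner's discount factor $\delta\in(0,1)$. An intergenerational insurance rule assigns to every history a consumption share $c\in(0,1)$ of the young (the old get $1-c$). It is sustainable if, after every history, $c\le s$ and the young are no worse off than in autarky, $\log c-\log s+\beta\,\mathbb E[\log(1-c')-\log(1-s')]\ge 0$. The planner's value $V(s,\omega)$ is the supremum of $\mathbb E\sum_t\delta^t\bigl(\tfrac{\beta}{\delta}\log(1-c_t)+\log c_t\bigr)$ over sustainable rules with $\log(1-c_0)\ge\omega$ and initial share $s$. Let $c^*(s)=\min\{\delta/(\beta+\delta),s\}$ and $d^*(s)=1-c^*(s)/s$. Let $d_{\max}$ be the largest $d\in[0,1)$ with $\log(1-d)+\beta\sum_r\pi(r)\bigl(\log(1-r+rd)-\log(1-r)\bigr)=0$.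 A promise $\omega$ to the old in share state $s$ corresponds to the debt $d$ through $\omega=\log(1-s+sd)$; feasible promises form $\Omega(s)=[\omega_{\min}(s),\omega_{\max}(s)]$, which corresponds to $d\in[0,d_{\max}]$. Let $\omega^0(s)$ be the largest maximizer of $V(s,\cdot)$ on $\Omega(s)$. For a state $x=(s,\omega)$, the policies $f(x)$ and $g_r(x)$ are the optimal $c$ and $\omega_r$ in $$\max\ \tfrac{\beta}{\delta}\log(1-c)+\log c+\delta\sum_r\pi(r)V(r,\omega_r)$$ subject to $\log(1-c)\ge\omega$, $c\le s$, $\omega_r\in\Omega(r)$ and $$\log c+\beta\sum_r\pi(r)\omega_r\ge\log s+\beta\sum_r\pi(r)\log(1-r),$$ with $g_r(x)\ge\omega^0(r)$ (which breaks ties in favour of the old). Let $\mu(x)\ge0$ be the Lagrange multiplier of the last constraint and $\nu=1+\mu$. The ergodic set $E$ is the (countable) set of states reached with positive probability, after one or more periods, from $(s(1),\omega^0(s(1)))$ under $x\mapsto x'=(r,g_r(x))$ with probability $\pi(r)$. States are also written $(s,d)$ with $d$ the corresponding debt, and $(i,d)$ for $(s(i),d)$. The growth-adjusted state prices are $q(x,x')=\pi(r)\,\beta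 f(x)/(1-f(x'))$ for $x'=(r,g_r(x))$, and $Q$ is their matrix. The price $p^k(x)$ of the $k$-period discount bond is the row sum of $Q^k$, and $y^k(x)=-\tfrac1k\log p^k(x)$. The unadjusted $p^k_+$, $y^k_+$ are obtained in the same way from the marginal rates of substitution between consumption levels, with growth shocks. A Perron pair of $Q$ on $E$ is a number $\varrho$ and a vector $\psi$ on $E$, bounded and bounded away from $0$ by a positive constant, with $Q\psi=\varrho\psi$; the Martin–Ross bound is $\Upsilon=\log(\sup_E\psi/\inf_E\psi)$. **Assumptions.** (a) $\sum_i\pi(i)\beta s(i)/(1-s(i))>\bar\gamma$. (b) $s(1)\le\delta/(\beta+\delta)$. (c) The first best is not sustainable: $\log c^*(s(I))+\beta\sum_r\pi(r)\log(1-c^*(r))<\log s(I)+\beta\sum_r\pi(r)\log(1-r)$. (d) The bounds on debt do not bind: $s(i)\ge\delta/(\beta+\delta)$ for all $i$ (so that, with (b), $s(1)=\delta/(\beta+\delta)$), and $d^*(s(I))<d_{\max}$. **Proposition.** Write $d^*(i)$ for $d^*(s(i))$. The state $(1,d^*(1))$ lies in $E$, the state $(I,d^*(I))$ lies in the closure $\overline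 E$, and: (i) $y^k_+(x)=y^k(x)+\log\bar\gamma$ for all $x\in\overline E$, $k\ge1$ (and every current aggregate endowment); (ii) for all $x\in\overline E$, $y^k(x)\to y^\infty=-\log\delta$ and $y^k_+(x)\to y^\infty+\log\bar\gamma$ as $k\to\infty$; (iii) for each $k\ge1$ and each $s$, $y^k(s,d)$ is (weakly) increasing in $d$ on $\overline E$; (iv) $y^\infty-y^1(1,d^*(1))>0>y^\infty-y^1(I,d^*(I))$; (v) $\nu_{\max}:=\sup_E\nu=\nu(I,d^*(I))$; a Perron pair of $Q$ on $E$ exists, and every Perron pair has $\varrho=\delta$ and Martin–Ross bound $\Upsilon=\log\nu_{\max}$. -/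

import Mathlib

open Filter Topology

noncomputable section

namespace OLG

/-- Primitives of the economy: `n + 2` endowment-share states (listed in increasing order), `J`
growth states, i.i.d. shocks, with shares and growth rates independent of each other. -/
structure Economy (n J : ℕ) where
  /-- generational discount factor -/
  β : ℝ
  /-- the planner's discount factor -/
  δ : ℝ
  /-- endowment share of the young -/
  s : Fin (n + 2) → ℝ
  /-- distribution of the endowment share -/
  π : Fin (n + 2) → ℝ
  /-- gross growth rates -/
  γ : Fin J → ℝ
  /-- distribution of the growth rate -/
  ς : Fin J → ℝ
  β_pos : 0 < β
  β_le_one : β ≤ 1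
  δ_pos : 0 < δ
  δ_lt_one : δ < 1
  s_pos : ∀ i, 0 < s i
  s_lt_one : ∀ i, s i < 1
  s_strictMono : StrictMono s
  π_pos : ∀ i, 0 < π i
  π_sum : ∑ i, π i = 1
  γ_pos : ∀ j, 0 < γ j
  ς_pos : ∀ j, 0 < ς j
  ς_sum : ∑ j, ς j = 1

/-- Histories of shocks after the initial date, the most recent shock first:
`[ρ_t, …, ρ_1]` with `ρ = (share state, growth state)`. -/
abbrev Hist (n J : ℕ) := List (Fin (n + 2) × Fin J)

/-- The pair (endowment-share state, utility promised to the old). -/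
abbrev State (n : ℕ) := Fin (n + 2) × ℝ

/-- The current endowment-share state after a history that started in the share state `i₀`. -/
def curShare {n J : ℕ} (i₀ : Fin (n + 2)) : Hist n J → Fin (n + 2)
  | [] => i₀
  | ρ :: _ => ρ.1

namespace Economy

variable {n J : ℕ} (M : Economy n J)

/-! ### Growth and first best -/

/-- Harmonic mean of the growth factors. -/
def gbar : ℝ := (∑ j, M.ς j * (M.γ j)⁻¹)⁻¹

/-- First-best consumption share of the young. -/
def cstar (i : Fin (n + 2)) : ℝ := min (M.δ / (M.β + M.δ)) (M.s i)

/-- First-best debt, relative to the endowment share of the young. -/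
def dstar (i : Fin (n + 2)) : ℝ := 1 - M.cstar i / M.s i

/-- Lifetime utility of the young in autarky (in terms of shares). -/
def autarky (i : Fin (n + 2)) : ℝ :=
  Real.log (M.s i) + M.β * ∑ r, M.π r * Real.log (1 - M.s r)

/-! ### Intergenerational insurance rules and the planner's value -/

/-- Lifetime utility gain over autarky of the generation born after the history `h`, when young
consume the shares given by the rule `c` and the initial share state is `i₀`. -/
def gain (i₀ : Fin (n + 2)) (c : Hist n J → ℝ) (h : Hist n J) : ℝ :=
  Real.log (c h) - Real.log (M.s (curShare i₀ h)) +
    M.β * ∑ ρ : Fin (n + 2) × Fin J, M.π ρ.1 * M.ς ρ.2 *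
      (Real.log (1 - c (ρ :: h)) - Real.log (1 - M.s ρ.1))

/-- Participation constraints of the old and of the young, after every history. -/
def Sustainable (i₀ : Fin (n + 2)) (c : Hist n J → ℝ) : Prop :=
  ∀ h, 0 < c h ∧ c h ≤ M.s (curShare i₀ h) ∧ 0 ≤ M.gain i₀ c h

/-- Expected payoff to the planner `t` periods after the history `h`. -/
def expPayoff (c : Hist n J → ℝ) : ℕ → Hist n J → ℝ
  | 0, h => M.β / M.δ * Real.log (1 - c h) + Real.log (c h)
  | t + 1, h => ∑ ρ : Fin (n + 2) × Fin J, M.π ρ.1 * M.ς ρ.2 * expPayoff c t (ρ :: h)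

/-- Expected discounted payoff to the planner. (The discounted sum of the expected lifetime
utilities of all generations, the initial old weighted by `β / δ`; not measured relative to
autarky, which only changes it by a constant that does not depend on the rule. For a sustainable
rule the payoffs are bounded, so that the series converges.) -/
def payoff (c : Hist n J → ℝ) : ℝ := ∑' t : ℕ, M.δ ^ t * M.expPayoff c t []

/-- The planner's value function: the best payoff from sustainable rules that give the initial old
at least the utility `w`, in the initial share state `i`. -/
def value (i : Fin (n + 2)) (w : ℝ) : ℝ :=
  sSup {v | ∃ c : Hist n J → ℝ, M.Sustainable i c ∧ w ≤ Real.log (1 - c []) ∧ v = M.payoff c}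

/-! ### Feasible promises and debt -/

/-- The debt limit: the nontrivial (i.e. largest) solution `d` in `[0, 1)` of the equation. -/
def dmax : ℝ :=
  sSup {d | 0 ≤ d ∧ d < 1 ∧
    Real.log (1 - d) +
      M.β * ∑ r, M.π r * (Real.log (1 - M.s r + M.s r * d) - Real.log (1 - M.s r)) = 0}

/-- The utility of the old in share state `i` that corresponds to the debt `d`. -/
def promise (i : Fin (n + 2)) (d : ℝ) : ℝ := Real.log (1 - M.s i + M.s i * d)

/-- The state with share state `i` and debt `d`. -/
def atDebt (i : Fin (n + 2)) (d : ℝ) : State n := (i, M.promise i d)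

/-- The debt `d` in state `x = (i, w)`: the solution of `w = log (1 - s + s d)`. -/
def debt (x : State n) : ℝ := (Real.exp x.2 - (1 - M.s x.1)) / M.s x.1

/-- Autarkic utility of the old: the smallest feasible promise. -/
def wmin (i : Fin (n + 2)) : ℝ := Real.log (1 - M.s i)

/-- The largest feasible promise: the one with debt at the debt limit. -/
def wmax (i : Fin (n + 2)) : ℝ := M.promise i M.dmax

/-- The largest promise that maximizes the planner's value. -/
def w0 (i : Fin (n + 2)) : ℝ :=
  sSup {w | w ∈ Set.Icc (M.wmin i) (M.wmax i) ∧
    ∀ w' ∈ Set.Icc (M.wmin i) (M.wmax i), M.value i w' ≤ M.value i w}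

/-! ### The recursive problem

A choice is a pair `a = (c, (w_r)_r)`: the consumption share of the young and the promises for the
next period. -/

/-- Objective of the recursive problem. -/
def objective (a : ℝ × (Fin (n + 2) → ℝ)) : ℝ :=
  M.β / M.δ * Real.log (1 - a.1) + Real.log a.1 + M.δ * ∑ r, M.π r * M.value r (a.2 r)

/-- Slack in the participation constraint of the young. -/
def slack (x : State n) (a : ℝ × (Fin (n + 2) → ℝ)) : ℝ :=
  Real.log a.1 + M.β * ∑ r, M.π r * a.2 r - M.autarky x.1

/-- All constraints other than the participation constraint of the young: promise keeping,
participation of the old, and the bounds on promises. -/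
def Relaxed (x : State n) (a : ℝ × (Fin (n + 2) → ℝ)) : Prop :=
  0 < a.1 ∧ x.2 ≤ Real.log (1 - a.1) ∧ a.1 ≤ M.s x.1 ∧
    ∀ r, M.wmin r ≤ a.2 r ∧ a.2 r ≤ M.wmax r

/-- The constraint set of the recursive problem. -/
def Feasible (x : State n) (a : ℝ × (Fin (n + 2) → ℝ)) : Prop :=
  M.Relaxed x a ∧ 0 ≤ M.slack x a

/-- An optimal choice in state `x`. The value function is constant on `[wmin r, w0 r]`; among
promises between which the planner is indifferent, the ones that give most to the old are
chosen, i.e. `w_r` lies in `[w0 r, wmax r]`. -/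
def IsOptimalChoice (x : State n) (a : ℝ × (Fin (n + 2) → ℝ)) : Prop :=
  M.Feasible x a ∧ (∀ b, M.Feasible x b → M.objective b ≤ M.objective a) ∧
    ∀ r, M.w0 r ≤ a.2 r

/-- The optimal choice in state `x`. -/
def policy (x : State n) : ℝ × (Fin (n + 2) → ℝ) := Classical.epsilon (M.IsOptimalChoice x)

/-- Policy function for the consumption share of the young. -/
def f (x : State n) : ℝ := (M.policy x).1

/-- The next-period state when the next-period share state is `r`. -/
def next (x : State n) (r : Fin (n + 2)) : State n := (r, (M.policy x).2 r)

/-- `μ` is a Lagrange multiplier of the participation constraint of the young in state `x`. -/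
def IsMultiplier (x : State n) (μ : ℝ) : Prop :=
  0 ≤ μ ∧ μ * M.slack x (M.policy x) = 0 ∧
    ∀ b, M.Relaxed x b →
      M.objective b + μ * M.slack x b ≤
        M.objective (M.policy x) + μ * M.slack x (M.policy x)

/-- The multiplier of the participation constraint of the young. -/
def mu (x : State n) : ℝ := Classical.epsilon (M.IsMultiplier x)

/-- `ν = 1 + μ`. -/
def nu (x : State n) : ℝ := 1 + M.mu x

/-- The ergodic set: the states that are reached with positive probability, after one or more
periods, from the resetting point of the first share state. (All share states have positive
probability, so these are the states at the end of a path of successive states.) -/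
def ergodicSet : Set (State n) :=
  {x | Relation.TransGen (fun y z => ∃ r, z = M.next y r) (0, M.w0 0) x}

/-! ### State prices, bonds and yields -/

/-- Intertemporal marginal rate of substitution with logarithmic utility, for consumption `Cy` when
young and `Co` when old: `β u'(Co) / u'(Cy)`. -/
def mrs (Cy Co : ℝ) : ℝ := M.β * (Co⁻¹ / Cy⁻¹)

/-- The matrix `Q` of growth-adjusted state prices, acting on functions of the state: row `x` has
the entries `π(r) m(x, x')` at the successors `x'` of `x` and zeros elsewhere. -/
def Q (φ : State n → ℝ) (x : State n) : ℝ :=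
  ∑ r, M.π r * M.mrs (M.f x) (1 - M.f (M.next x r)) * φ (M.next x r)

/-- Price of the `k`-period discount bond: the row sum of `Q ^ k`. -/
def price (k : ℕ) : State n → ℝ := M.Q^[k] (fun _ => 1)

/-- Growth-adjusted yield of the `k`-period bond. -/
def yield (k : ℕ) (x : State n) : ℝ := -(1 / (k : ℝ)) * Real.log (M.price k x)

/-- The unadjusted state prices, for consumption in levels, acting on functions of the state and of
the aggregate endowment `e`. -/
def Qplus (φ : State n × ℝ → ℝ) (z : State n × ℝ) : ℝ :=
  ∑ r, ∑ j, M.π r * M.ς j *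
    M.mrs (M.f z.1 * z.2) ((1 - M.f (M.next z.1 r)) * (M.γ j * z.2)) *
      φ (M.next z.1 r, M.γ j * z.2)

/-- Unadjusted price of the `k`-period discount bond. -/
def pricePlus (k : ℕ) : State n × ℝ → ℝ := M.Qplus^[k] (fun _ => 1)

/-- Unadjusted yield of the `k`-period bond. -/
def yieldPlus (k : ℕ) (z : State n × ℝ) : ℝ := -(1 / (k : ℝ)) * Real.log (M.pricePlus k z)

/-- `ϱ` and `ψ` are the Perron root and a Perron eigenvector of `Q` on the ergodic set. The ergodic
set is countable; positivity of the vector is uniform, and the vector is bounded (both are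
automatic on a finite set). -/
def IsPerronPair (ϱ : ℝ) (ψ : State n → ℝ) : Prop :=
  (∃ a b : ℝ, 0 < a ∧ ∀ x ∈ M.ergodicSet, a ≤ ψ x ∧ ψ x ≤ b) ∧
    ∀ x ∈ M.ergodicSet, M.Q ψ x = ϱ * ψ x

/-- The Martin–Ross bound of an eigenvector. -/
def martinRoss (ψ : State n → ℝ) : ℝ :=
  Real.log (sSup (ψ '' M.ergodicSet) / sInf (ψ '' M.ergodicSet))

end Economy

end OLG

end

open Filter Topology

noncomputable section

namespace OLG

namespace Economy

section

variable {n J : ℕ} (M : Economy n J)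

/-! ### Consumption as a function of the logarithmic ratio of successive multipliers -/

/-! A state is indexed by the multiplier of the previous date. If the multiplier moves from `exp θ`
to `exp m`, the first-order condition fixes the share of the young at `young (m - θ)`, with `young
0` the first best. One recursion then describes the optimum: `N r θ` is the least `m ≥ 0` at which
the young participate when the old are to receive `W r' m`, and consistency requires `W r θ = oldU
(N r θ - θ)`. The recursion is monotone in `W` and preserves functions that are nondecreasing and
1-Lipschitz in `θ`, so its greatest subsolution is a solution (`greatest_eq_update`). A subsolution
above autarky comes from debt kept below the debt limit (`exists_subsolution`). The value function
plays no role up to this point.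

Optimality is weak duality. With the multipliers of the generated path the Lagrangian telescopes
over dates, each date's term is maximized by `young`, and the remainder is discounted away
(`payoff_le`). This yields the value and a supergradient at each `W r θ` (`value_lt_tangent`), hence
`w0`, the unique policy and the unique multiplier (`w0_eq`, `policy_eq`, `nu_eq`).

In the lowest share state participation is slack at multiplier one, so the log multiplier falls by a
fixed amount until it reaches 0 (`exists_reset`). In the highest one it climbs to `cap`, where
consumption is again first best. The ergodic set thus lies in `0 ≤ θ ≤ cap`, and the two states
singled out in the proposition are the lowest share with `θ = 0` and the highest share with `θ =
cap`.

The ratio ψ = f/ν (`kernel`) satisfies 1 - f = (β/δ) exp θ ψ, so βf(x)/(1 - f(x')) = δψ(x)/ψ(x'):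
`Q` is δ times the transition matrix, conjugated by ψ. So ψ is a Perron vector with root δ, and bond
prices are `δ ^ k` up to bounded factors. Any other Perron vector divided by ψ is bounded and
harmonic, hence constant, because every state can be reset (`eq_start_of_harmonic`). The extremes of
ψ have ratio `exp cap`, which is the supremum of ν. -/

/-- Consumption share of the young if the multiplier grows by the factor `exp y`. -/
def young (y : ℝ) : ℝ := M.δ * Real.exp y / (M.β + M.δ * Real.exp y)

/-- Utility of the old if the multiplier grows by the factor `exp y`. -/
def oldU (y : ℝ) : ℝ := Real.log (1 - M.young y)

/-- Expectation over the share states. -/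
def mean (φ : Fin (n + 2) → ℝ) : ℝ := ∑ r, M.π r * φ r

lemma den_pos (y : ℝ) : 0 < M.β + M.δ * Real.exp y := by
  have := M.β_pos; have := M.δ_pos; positivity

lemma one_sub_young (y : ℝ) : 1 - M.young y = M.β / (M.β + M.δ * Real.exp y) := by
  have := (M.den_pos y).ne'
  unfold young; field_simp; ring

lemma young_pos (y : ℝ) : 0 < M.young y :=
  div_pos (mul_pos M.δ_pos (Real.exp_pos y)) (M.den_pos y)

lemma one_sub_young_pos (y : ℝ) : 0 < 1 - M.young y := by
  rw [one_sub_young]; exact div_pos M.β_pos (M.den_pos y)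

lemma young_strictMono : StrictMono M.young := by
  intro y y' h
  have h1 : 1 - M.young y' < 1 - M.young y := by
    rw [one_sub_young, one_sub_young]
    apply div_lt_div_of_pos_left M.β_pos (M.den_pos y)
    have := mul_lt_mul_of_pos_left (Real.exp_lt_exp.2 h) M.δ_pos
    linarith
  linarith

lemma young_zero : M.young 0 = M.δ / (M.β + M.δ) := by simp [young]

lemma young_continuous : Continuous M.young := by
  unfold young
  exact (by fun_prop : Continuous fun y => M.δ * Real.exp y).div (by fun_prop)
    fun y => (M.den_pos y).ne'

lemma log_young_continuous : Continuous fun y => Real.log (M.young y) :=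
  M.young_continuous.log fun y => (M.young_pos y).ne'

lemma log_young_strictMono : StrictMono fun y => Real.log (M.young y) :=
  fun _ _ h => Real.log_lt_log (M.young_pos _) (M.young_strictMono h)

lemma oldU_strictAnti : StrictAnti M.oldU := fun _ _ h =>
  Real.log_lt_log (M.one_sub_young_pos _) (by linarith [M.young_strictMono h])

lemma oldU_neg (y : ℝ) : M.oldU y < 0 :=
  Real.log_neg (M.one_sub_young_pos y) (by linarith [M.young_pos y])

/-- The slope of `oldU` is `-young`, which lies in (-1, 0). -/
lemma oldU_lipschitz {y y' : ℝ} (h : y ≤ y') : M.oldU y ≤ M.oldU y' + (y' - y) := by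
  unfold oldU
  rw [one_sub_young, one_sub_young, ← Real.log_exp (y' - y),
    ← Real.log_mul (div_pos M.β_pos (M.den_pos y')).ne' (Real.exp_pos _).ne']
  apply Real.log_le_log (div_pos M.β_pos (M.den_pos y))
  rw [div_mul_eq_mul_div, div_le_div_iff₀ (M.den_pos y) (M.den_pos y')]
  have h1 : Real.exp y' = Real.exp (y' - y) * Real.exp y := by rw [← Real.exp_add]; ring_nf
  have h2 : 1 ≤ Real.exp (y' - y) := Real.one_le_exp (by linarith)
  rw [h1]
  have := M.β_pos
  have := M.δ_pos
  nlinarith [mul_nonneg (mul_nonneg M.β_pos.le M.β_pos.le) (sub_nonneg.2 h2)]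

lemma mean_mono {φ φ' : Fin (n + 2) → ℝ} (h : ∀ r, φ r ≤ φ' r) : M.mean φ ≤ M.mean φ' :=
  Finset.sum_le_sum fun r _ => mul_le_mul_of_nonneg_left (h r) (M.π_pos r).le

lemma mean_lt {φ φ' : Fin (n + 2) → ℝ} (h : ∀ r, φ r ≤ φ' r) (r₀ : Fin (n + 2))
    (h₀ : φ r₀ < φ' r₀) : M.mean φ < M.mean φ' :=
  Finset.sum_lt_sum (fun r _ => mul_le_mul_of_nonneg_left (h r) (M.π_pos r).le)
    ⟨r₀, Finset.mem_univ _, mul_lt_mul_of_pos_left h₀ (M.π_pos r₀)⟩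

lemma mean_const (a : ℝ) : M.mean (fun _ => a) = a := by
  simp [mean, ← Finset.sum_mul, M.π_sum]

lemma mean_sub (φ φ' : Fin (n + 2) → ℝ) :
    M.mean (fun r => φ r - φ' r) = M.mean φ - M.mean φ' := by
  simp [mean, mul_sub, Finset.sum_sub_distrib]

lemma mean_mul_left (a : ℝ) (φ : Fin (n + 2) → ℝ) :
    M.mean (fun r => a * φ r) = a * M.mean φ := by
  simp only [mean, Finset.mul_sum]; exact Finset.sum_congr rfl fun _ _ => by ring

lemma autarky_eq (i : Fin (n + 2)) : M.autarky i = Real.log (M.s i) + M.β * M.mean M.wmin := rfl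

lemma autarky_mono {i j : Fin (n + 2)} (h : i ≤ j) : M.autarky i ≤ M.autarky j := by
  rw [autarky_eq, autarky_eq]
  have := Real.log_le_log (M.s_pos i) (M.s_strictMono.monotone h)
  linarith

/-! ### Constant debt -/

/-- Utility gain of the old, in expectation, from the debt `d`. -/
def oldGain (d : ℝ) : ℝ := M.β * M.mean (fun r => M.promise r d - M.wmin r)

/-- Utility gain of a generation if the debt is always `d`. -/
def debtGain (d : ℝ) : ℝ := Real.log (1 - d) + M.oldGain d

lemma promise_arg_pos (i : Fin (n + 2)) {d : ℝ} (hd : 0 ≤ d) : 0 < 1 - M.s i + M.s i * d := by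
  have := M.s_lt_one i; have := mul_nonneg (M.s_pos i).le hd; linarith

lemma promise_zero (i : Fin (n + 2)) : M.promise i 0 = M.wmin i := by simp [promise, wmin]

lemma promise_lt (i : Fin (n + 2)) {d d' : ℝ} (hd : 0 ≤ d) (h : d < d') :
    M.promise i d < M.promise i d' :=
  Real.log_lt_log (M.promise_arg_pos i hd) (by nlinarith [M.s_pos i])

lemma promise_le (i : Fin (n + 2)) {d d' : ℝ} (hd : 0 ≤ d) (h : d ≤ d') :
    M.promise i d ≤ M.promise i d' :=
  Real.log_le_log (M.promise_arg_pos i hd) (by nlinarith [M.s_pos i])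

lemma promise_concave (i : Fin (n + 2)) {t d : ℝ} (ht : 0 ≤ t) (ht' : t ≤ 1) (hd : 0 ≤ d) :
    t * (M.promise i d - M.wmin i) ≤ M.promise i (t * d) - M.wmin i := by
  have h := strictConcaveOn_log_Ioi.concaveOn.2 (x := 1 - M.s i) (y := 1 - M.s i + M.s i * d)
    (by simpa using M.s_lt_one i) (M.promise_arg_pos i hd) (sub_nonneg.2 ht') ht (by ring)
  simp only [smul_eq_mul] at h
  have e : (1 - t) * (1 - M.s i) + t * (1 - M.s i + M.s i * d) = 1 - M.s i + M.s i * (t * d) := by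
    ring
  rw [e] at h
  unfold promise wmin
  linarith

lemma oldGain_concave {t d : ℝ} (ht : 0 ≤ t) (ht' : t ≤ 1) (hd : 0 ≤ d) :
    t * M.oldGain d ≤ M.oldGain (t * d) := by
  have h := M.mean_mono fun r => M.promise_concave r ht ht' hd
  rw [mean_mul_left] at h
  unfold oldGain
  nlinarith [M.β_pos]

lemma oldGain_mono {d d' : ℝ} (hd : 0 ≤ d) (h : d ≤ d') : M.oldGain d ≤ M.oldGain d' :=
  mul_le_mul_of_nonneg_left (M.mean_mono fun r => by linarith [M.promise_le r hd h]) M.β_pos.le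

lemma log_concave_one {t d : ℝ} (ht : 0 ≤ t) (ht' : t ≤ 1) (hd1 : d < 1) :
    t * Real.log (1 - d) ≤ Real.log (1 - t * d) := by
  have h := strictConcaveOn_log_Ioi.concaveOn.2 (x := 1) (y := 1 - d)
    (by simp) (by simpa using hd1) (sub_nonneg.2 ht') ht (by ring)
  simp only [smul_eq_mul, Real.log_one] at h
  have e : (1 - t) * 1 + t * (1 - d) = 1 - t * d := by ring
  rw [e] at h
  linarith

lemma log_strictConcave_one {t d : ℝ} (ht : 0 < t) (ht' : t < 1) (hd : 0 < d) (hd1 : d < 1) :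
    t * Real.log (1 - d) < Real.log (1 - t * d) := by
  have h := strictConcaveOn_log_Ioi.2 (x := 1) (y := 1 - d)
    (by simp) (by simpa using hd1) (by linarith) (sub_pos.2 ht') ht (by ring)
  simp only [smul_eq_mul, Real.log_one] at h
  have e : (1 - t) * 1 + t * (1 - d) = 1 - t * d := by ring
  rw [e] at h
  linarith

/-- A secant inequality from the zero at `d = 0`; the term `log (1 - d)` alone supplies the
strictness. -/
lemma debtGain_strictConcave {t d : ℝ} (ht : 0 < t) (ht' : t < 1) (hd : 0 < d) (hd1 : d < 1) :
    t * M.debtGain d < M.debtGain (t * d) := by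
  have h1 := log_strictConcave_one ht ht' hd hd1
  have h2 := M.oldGain_concave ht.le ht'.le hd.le
  unfold debtGain; linarith

/-- A strictly concave function that starts at zero cannot recover once it has become nonpositive.
Hence there is at most one positive zero, and the supremum in `dmax` is attained. -/
lemma debtGain_neg_of_gt {d d' : ℝ} (hd : 0 < d) (h : d < d') (hd1 : d' < 1)
    (h0 : M.debtGain d ≤ 0) : M.debtGain d' < 0 := by
  have hd' : 0 < d' := hd.trans h
  have := M.debtGain_strictConcave (t := d / d') (div_pos hd hd') ((div_lt_one hd').2 h) hd' hd1
  rw [div_mul_cancel₀ _ hd'.ne'] at this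
  by_contra hc
  have := mul_nonneg (div_pos hd hd').le (not_lt.1 hc)
  linarith

lemma debtGain_zero : M.debtGain 0 = 0 := by
  simp [debtGain, oldGain, promise_zero, mean]

lemma dmax_eq : M.dmax = sSup {d | 0 ≤ d ∧ d < 1 ∧ M.debtGain d = 0} := rfl

/-- If the debt limit is positive, it is a zero of `debtGain` in `(0, 1)`. -/
lemma dmax_spec (h : 0 < M.dmax) : M.dmax < 1 ∧ M.debtGain M.dmax = 0 := by
  have hne : {d | 0 ≤ d ∧ d < 1 ∧ M.debtGain d = 0}.Nonempty :=
    ⟨0, le_rfl, one_pos, M.debtGain_zero⟩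
  obtain ⟨d, ⟨hd0, hd1, hd⟩, hpos⟩ := exists_lt_of_lt_csSup hne (M.dmax_eq ▸ h)
  have hg : IsGreatest {d | 0 ≤ d ∧ d < 1 ∧ M.debtGain d = 0} d := by
    refine ⟨⟨hd0, hd1, hd⟩, fun d' hd' => ?_⟩
    by_contra hc
    have := M.debtGain_neg_of_gt hpos (not_le.1 hc) hd'.2.1 hd.le
    linarith [hd'.2.2]
  rw [dmax_eq, hg.csSup_eq]
  exact ⟨hd1, hd⟩

lemma debtGain_pos (h : 0 < M.dmax) {d : ℝ} (hd : 0 < d) (hd' : d < M.dmax) :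
    0 < M.debtGain d := by
  have h1 := M.dmax_spec h
  have := M.debtGain_strictConcave (t := d / M.dmax) (div_pos hd h) ((div_lt_one h).2 hd') h h1.1
  rw [div_mul_cancel₀ _ h.ne', h1.2] at this
  linarith

lemma le_dmax (h : 0 < M.dmax) {d : ℝ} (hd1 : d < 1) (hd' : 0 ≤ M.debtGain d) :
    d ≤ M.dmax := by
  by_contra hc
  have := M.debtGain_neg_of_gt h (not_le.1 hc) hd1 (M.dmax_spec h).2.le
  linarith

end

section

variable {n J : ℕ} (M : Economy n J)

/-! ### The recursion for the multipliers

`W r θ` is the utility of the old in the share state `r` if the logarithm of the multiplier of the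
previous period is `θ ≥ 0`. -/

/-- Nondecreasing and `1`-Lipschitz on `[0, ∞)`. -/
structure Admissible (W : Fin (n + 2) → ℝ → ℝ) : Prop where
  mono : ∀ r θ θ', 0 ≤ θ → θ ≤ θ' → W r θ ≤ W r θ'
  lip : ∀ r θ θ', 0 ≤ θ → θ ≤ θ' → W r θ' ≤ W r θ + (θ' - θ)

/-- Logarithms of multipliers at which the young participate. -/
def feas (W : Fin (n + 2) → ℝ → ℝ) (r : Fin (n + 2)) (θ : ℝ) : Set ℝ :=
  {m | 0 ≤ m ∧ M.autarky r ≤ Real.log (M.young (m - θ)) + M.β * M.mean (fun r' => W r' m)}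

/-- The logarithm of the next multiplier. -/
def nextLog (W : Fin (n + 2) → ℝ → ℝ) (r : Fin (n + 2)) (θ : ℝ) : ℝ := sInf (M.feas W r θ)

/-- The update of the utility of the old. -/
def update (W : Fin (n + 2) → ℝ → ℝ) (r : Fin (n + 2)) (θ : ℝ) : ℝ :=
  M.oldU (M.nextLog W r θ - θ)

/-- Admissible functions that increase under `update`. -/
def subsolutions : Set (Fin (n + 2) → ℝ → ℝ) :=
  {W | Admissible W ∧ ∀ r θ, 0 ≤ θ → ∃ m ∈ M.feas W r θ, W r θ ≤ M.oldU (m - θ)}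

variable {M}

lemma Admissible.continuousOn {W : Fin (n + 2) → ℝ → ℝ} (hW : Admissible W) (r : Fin (n + 2)) :
    ContinuousOn (W r) (Set.Ici 0) := by
  apply LipschitzOnWith.continuousOn (K := 1)
  apply LipschitzOnWith.of_le_add_mul
  intro x hx y hy
  simp only [NNReal.coe_one, one_mul]
  rcases le_total x y with h | h
  · have := hW.mono r x y hx h
    linarith [dist_nonneg (x := x) (y := y)]
  · have := hW.lip r y x hy h
    rwa [Real.dist_eq, abs_of_nonneg (sub_nonneg.2 h)]

lemma Admissible.mean_continuousOn {W : Fin (n + 2) → ℝ → ℝ} (hW : Admissible W) :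
    ContinuousOn (fun m => M.mean (fun r => W r m)) (Set.Ici 0) :=
  continuousOn_finsetSum _ fun r _ => continuousOn_const.mul (hW.continuousOn r)

lemma Admissible.participation_continuousOn {W : Fin (n + 2) → ℝ → ℝ} (hW : Admissible W)
    (θ : ℝ) : ContinuousOn
      (fun m => Real.log (M.young (m - θ)) + M.β * M.mean (fun r' => W r' m)) (Set.Ici 0) :=
  (M.log_young_continuous.comp (continuous_id.sub continuous_const)).continuousOn.add
    (continuousOn_const.mul hW.mean_continuousOn)

lemma nextLog_mem {W : Fin (n + 2) → ℝ → ℝ} (hW : Admissible W) {r : Fin (n + 2)} {θ : ℝ}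
    (hne : (M.feas W r θ).Nonempty) : M.nextLog W r θ ∈ M.feas W r θ := by
  have hcl : IsClosed (M.feas W r θ) :=
    (hW.participation_continuousOn (M := M) θ).preimage_isClosed_of_isClosed isClosed_Ici
      (isClosed_Ici (a := M.autarky r))
  exact hcl.csInf_mem hne ⟨0, fun m hm => hm.1⟩

lemma nextLog_le {W : Fin (n + 2) → ℝ → ℝ} {r : Fin (n + 2)} {θ m : ℝ}
    (hm : m ∈ M.feas W r θ) : M.nextLog W r θ ≤ m :=
  csInf_le ⟨0, fun _ h => h.1⟩ hm

lemma feas_mono {W W' : Fin (n + 2) → ℝ → ℝ} (h : ∀ r θ, 0 ≤ θ → W r θ ≤ W' r θ)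
    (r : Fin (n + 2)) (θ : ℝ) : M.feas W r θ ⊆ M.feas W' r θ := fun m hm =>
  ⟨hm.1, hm.2.trans (by
    have := mul_le_mul_of_nonneg_left (M.mean_mono fun r' => h r' m hm.1) M.β_pos.le
    linarith)⟩

/-- At a fixed `m`, a lower `θ` only raises the consumption of the young, so `m` stays feasible. -/
lemma nextLog_mono {W : Fin (n + 2) → ℝ → ℝ} (hW : Admissible W)
    (hne : ∀ r θ, 0 ≤ θ → (M.feas W r θ).Nonempty) (r : Fin (n + 2)) {θ θ' : ℝ} (hθ : 0 ≤ θ)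
    (h : θ ≤ θ') : M.nextLog W r θ ≤ M.nextLog W r θ' := by
  have hm := nextLog_mem hW (hne r θ' (hθ.trans h))
  refine nextLog_le ⟨hm.1, hm.2.trans ?_⟩
  have := M.log_young_strictMono.monotone
    (by linarith : M.nextLog W r θ' - θ' ≤ M.nextLog W r θ' - θ)
  linarith

/-- Shifting `m` and `θ` together leaves consumption unchanged and raises the promises, so
feasibility is kept. -/
lemma nextLog_lip {W : Fin (n + 2) → ℝ → ℝ} (hW : Admissible W)
    (hne : ∀ r θ, 0 ≤ θ → (M.feas W r θ).Nonempty) (r : Fin (n + 2)) {θ θ' : ℝ} (hθ : 0 ≤ θ)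
    (h : θ ≤ θ') : M.nextLog W r θ' ≤ M.nextLog W r θ + (θ' - θ) := by
  have hm := nextLog_mem hW (hne r θ hθ)
  refine nextLog_le ⟨by linarith [hm.1], hm.2.trans ?_⟩
  have := mul_le_mul_of_nonneg_left (M.mean_mono fun r' => hW.mono r' _
    (M.nextLog W r θ + (θ' - θ)) hm.1 (by linarith)) M.β_pos.le
  rw [show M.nextLog W r θ + (θ' - θ) - θ' = M.nextLog W r θ - θ by ring]
  linarith

/-- By the two preceding bounds `nextLog - θ` has slope in [-1, 0], and `oldU` has slope in (-1, 0);
the composite has slope in [0, 1]. -/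
lemma update_admissible {W : Fin (n + 2) → ℝ → ℝ} (hW : Admissible W)
    (hne : ∀ r θ, 0 ≤ θ → (M.feas W r θ).Nonempty) : Admissible (M.update W) where
  mono r θ θ' hθ h :=
    M.oldU_strictAnti.antitone (by linarith [nextLog_lip hW hne r hθ h])
  lip r θ θ' hθ h := by
    have h1 := nextLog_lip hW hne r hθ h
    have h2 := nextLog_mono hW hne r hθ h
    have := M.oldU_lipschitz (y := M.nextLog W r θ' - θ') (y' := M.nextLog W r θ - θ)
      (by linarith)
    unfold update
    linarith

lemma subsolution_nonpos {W : Fin (n + 2) → ℝ → ℝ} (hW : W ∈ M.subsolutions) (r : Fin (n + 2))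
    {θ : ℝ} (hθ : 0 ≤ θ) : W r θ ≤ 0 := by
  obtain ⟨m, -, hm⟩ := hW.2 r θ hθ
  exact hm.trans (M.oldU_neg _).le

/-! ### Existence of a fixed point by the greatest subsolution. -/

variable (M) in
/-- The greatest subsolution. -/
def greatest (r : Fin (n + 2)) (θ : ℝ) : ℝ := sSup {w | ∃ W ∈ M.subsolutions, w = W r θ}

lemma le_greatest {W : Fin (n + 2) → ℝ → ℝ} (hW : W ∈ M.subsolutions) (r : Fin (n + 2))
    {θ : ℝ} (hθ : 0 ≤ θ) : W r θ ≤ M.greatest r θ := by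
  refine le_csSup ⟨0, ?_⟩ ⟨W, hW, rfl⟩
  rintro w ⟨W', hW', rfl⟩
  exact subsolution_nonpos hW' r hθ

lemma greatest_le (hne : M.subsolutions.Nonempty) (r : Fin (n + 2)) {θ b : ℝ}
    (hb : ∀ W ∈ M.subsolutions, W r θ ≤ b) : M.greatest r θ ≤ b := by
  obtain ⟨W, hW⟩ := hne
  refine csSup_le ⟨_, W, hW, rfl⟩ ?_
  rintro w ⟨W', hW', rfl⟩
  exact hb W' hW'

lemma greatest_admissible (hne : M.subsolutions.Nonempty) : Admissible M.greatest where
  mono r θ θ' hθ h := greatest_le hne r fun W hW =>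
    (hW.1.mono r θ θ' hθ h).trans (le_greatest hW r (hθ.trans h))
  lip r θ θ' hθ h := greatest_le hne r fun W hW =>
    (hW.1.lip r θ θ' hθ h).trans (by linarith [le_greatest hW r hθ])

lemma greatest_feas_nonempty (hne : M.subsolutions.Nonempty) (r : Fin (n + 2)) (θ : ℝ)
    (hθ : 0 ≤ θ) : (M.feas M.greatest r θ).Nonempty := by
  obtain ⟨W, hW⟩ := hne
  obtain ⟨m, hm, -⟩ := hW.2 r θ hθ
  exact ⟨m, feas_mono (fun r θ hθ => le_greatest hW r hθ) r θ hm⟩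

lemma greatest_le_update (hne : M.subsolutions.Nonempty) (r : Fin (n + 2)) {θ : ℝ}
    (hθ : 0 ≤ θ) : M.greatest r θ ≤ M.update M.greatest r θ := by
  refine greatest_le hne r fun W hW => ?_
  obtain ⟨m, hm, hle⟩ := hW.2 r θ hθ
  refine hle.trans (M.oldU_strictAnti.antitone ?_)
  have := nextLog_le (feas_mono (fun r θ hθ => le_greatest hW r hθ) r θ hm)
  linarith

/-- The Knaster–Tarski argument: `update` of the greatest subsolution is again a subsolution, so it
lies below the greatest one. -/
lemma greatest_eq_update (hne : M.subsolutions.Nonempty) (r : Fin (n + 2)) {θ : ℝ}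
    (hθ : 0 ≤ θ) : M.greatest r θ = M.update M.greatest r θ := by
  refine le_antisymm (greatest_le_update hne r hθ) (le_greatest (W := M.update M.greatest) ?_ r hθ)
  have hne' := greatest_feas_nonempty hne
  refine ⟨update_admissible (greatest_admissible hne) hne', fun r θ hθ => ?_⟩
  exact ⟨M.nextLog M.greatest r θ, feas_mono (fun r θ hθ => greatest_le_update hne r hθ) r θ
    (nextLog_mem (greatest_admissible hne) (hne' r θ hθ)), le_rfl⟩

/-! ### A subsolution with small slopes -/

variable (M) in
/-- The maintained assumptions, if the bounds on debt do not bind. -/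
structure Nonbinding : Prop where
  s_zero : M.s 0 = M.young 0
  no_first_best : Real.log (M.young 0) + M.β * M.oldU 0 < M.autarky (Fin.last (n + 1))
  limit : 1 - M.young 0 / M.s (Fin.last (n + 1)) < M.dmax

lemma Nonbinding.young_zero_le (h : M.Nonbinding) (i : Fin (n + 2)) : M.young 0 ≤ M.s i := by
  rw [← h.s_zero]; exact M.s_strictMono.monotone (Fin.zero_le i)

lemma Nonbinding.young_zero_lt (h : M.Nonbinding) : M.young 0 < M.s (Fin.last (n + 1)) := by
  rw [← h.s_zero]; exact M.s_strictMono (Fin.last_pos)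

lemma Nonbinding.dstar_pos (h : M.Nonbinding) :
    0 < 1 - M.young 0 / M.s (Fin.last (n + 1)) := by
  have := (div_lt_one (M.s_pos (Fin.last (n + 1)))).2 h.young_zero_lt
  linarith

lemma Nonbinding.dmax_pos (h : M.Nonbinding) : 0 < M.dmax := h.dstar_pos.trans h.limit

variable (M) in
/-- Utility of the old if the debt grows linearly, with slope `a`, up to the level `D`. -/
def rampU (a D : ℝ) (r : Fin (n + 2)) (θ : ℝ) : ℝ := M.promise r (min (a * θ) D)

/-- The slope of `promise r` along the ramp is at most `s a / (1 - s)`, which `has` bounds by one.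
-/
lemma rampU_admissible {a D : ℝ} (ha : 0 ≤ a) (hD : 0 ≤ D)
    (has : ∀ r, M.s r * a ≤ 1 - M.s r) : Admissible (M.rampU a D) where
  mono r θ θ' hθ h := M.promise_le r (le_min (mul_nonneg ha hθ) hD)
    (min_le_min_right _ (mul_le_mul_of_nonneg_left h ha))
  lip r θ θ' hθ h := by
    unfold rampU promise
    have hd : 0 ≤ min (a * θ) D := le_min (mul_nonneg ha hθ) hD
    have hd' : min (a * θ') D ≤ min (a * θ) D + a * (θ' - θ) := by
      rcases min_choice (a * θ) D with e | e <;> rw [e]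
      · exact (min_le_left _ _).trans (by linarith)
      · exact (min_le_right _ _).trans (by nlinarith)
    have hd'' : 0 ≤ min (a * θ') D := le_min (mul_nonneg ha (hθ.trans h)) hD
    have p1 := M.promise_arg_pos r hd
    have p2 := M.promise_arg_pos r hd''
    rw [← sub_le_iff_le_add', ← Real.log_div p2.ne' p1.ne']
    refine (Real.log_le_sub_one_of_pos (div_pos p2 p1)).trans ?_
    rw [sub_le_iff_le_add, div_le_iff₀ p1]
    have h1 := mul_le_mul_of_nonneg_left hd' (M.s_pos r).le
    have h2 := mul_le_mul_of_nonneg_right (has r) (sub_nonneg.2 h)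
    have h3 := mul_nonneg (sub_nonneg.2 h) (mul_nonneg (M.s_pos r).le hd)
    nlinarith

/-- The multiplier that supports the debt `d` falls at most linearly in `d`. -/
lemma exists_young_eq (h : M.Nonbinding) (r : Fin (n + 2)) {d D : ℝ} (hd : 0 ≤ d) (hdD : d ≤ D)
    (hD : D < 1) : ∃ y, M.young y = M.s r * (1 - d) ∧
      -((1 / (1 - D) + M.s r / (1 - M.s r)) * d) ≤ y := by
  have hs := M.s_pos r
  have hs1 : 0 < 1 - M.s r := by linarith [M.s_lt_one r]
  have hd1 : 0 < 1 - d := by linarith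
  have hD1 : 0 < 1 - D := by linarith
  have hβ := M.β_pos
  have hδ := M.δ_pos
  set c := M.s r * (1 - d) with hc
  have hc0 : 0 < c := mul_pos hs hd1
  have hc1 : 0 < 1 - c := by nlinarith
  refine ⟨Real.log (M.β / M.δ * (c / (1 - c))), ?_, ?_⟩
  · unfold young
    rw [Real.exp_log (by positivity)]
    have : M.β + M.δ * (M.β / M.δ * (c / (1 - c))) = M.β / (1 - c) := by
      field_simp; ring
    rw [this]; field_simp
  -- The first-best share is at most `s r`, so this factor is at least one and can be dropped from
  -- the lower bound.
  · have hk : 1 ≤ M.β / M.δ * (M.s r / (1 - M.s r)) := by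
      have := h.young_zero_le r
      rw [young_zero, div_le_iff₀ (by positivity)] at this
      rw [div_mul_div_comm, le_div_iff₀ (by positivity)]
      nlinarith
    have e : M.β / M.δ * (c / (1 - c)) =
        (M.β / M.δ * (M.s r / (1 - M.s r))) * ((1 - d) / (1 + M.s r / (1 - M.s r) * d)) := by
      have : 1 - c = (1 - M.s r) * (1 + M.s r / (1 - M.s r) * d) := by
        rw [hc]; field_simp; ring
      rw [this, hc]
      have : 0 < 1 + M.s r / (1 - M.s r) * d := by positivity
      field_simp
    have hq : 0 < 1 + M.s r / (1 - M.s r) * d := by positivity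
    have h1 : Real.log ((1 - d) / (1 + M.s r / (1 - M.s r) * d)) ≤
        Real.log (M.β / M.δ * (c / (1 - c))) := by
      rw [e]
      apply Real.log_le_log (by positivity)
      exact le_mul_of_one_le_left (by positivity) hk
    refine le_trans ?_ h1
    rw [Real.log_div hd1.ne' hq.ne']
    have h2 : Real.log (1 + M.s r / (1 - M.s r) * d) ≤ M.s r / (1 - M.s r) * d := by
      have := Real.log_le_sub_one_of_pos hq; linarith
    have h3 : -(1 / (1 - D) * d) ≤ Real.log (1 - d) := by
      have := Real.one_sub_inv_le_log_of_pos hd1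
      have h4 : (1 - d)⁻¹ - 1 ≤ 1 / (1 - D) * d := by
        have : (1 - d)⁻¹ - 1 = (1 - d)⁻¹ * d := by field_simp; ring
        rw [this, one_div]
        exact mul_le_mul_of_nonneg_right (inv_anti₀ hD1 (by linarith)) hd
      linarith
    linarith

/-- There is a subsolution that exceeds autarky and approaches more than the first-best debt. -/
lemma exists_subsolution (h : M.Nonbinding) : ∃ L ∈ M.subsolutions,
    (∀ r θ, 0 ≤ θ → M.wmin r ≤ L r θ) ∧ (∀ r θ, 0 < θ → M.wmin r < L r θ) ∧
    ∃ Θ, 0 ≤ Θ ∧ M.autarky (Fin.last (n + 1)) ≤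
      Real.log (M.young 0) + M.β * M.mean (fun r => L r Θ) := by
  set dI := 1 - M.young 0 / M.s (Fin.last (n + 1)) with hdI
  have hdI0 : 0 < dI := h.dstar_pos
  obtain ⟨D, hD1, hD2⟩ := exists_between h.limit
  have hD0 : 0 < D := hdI0.trans hD1
  have hDlt : D < 1 := hD2.trans (M.dmax_spec h.dmax_pos).1
  have hgain := M.debtGain_pos h.dmax_pos hD0 hD2
  have hlogneg : Real.log (1 - D) < 0 := Real.log_neg (by linarith) (by linarith)
  have hOG : 0 < M.oldGain D := by unfold debtGain at hgain; linarith
  set S := M.s (Fin.last (n + 1)) with hS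
  have hS0 : 0 < S := M.s_pos _
  have hS1 : 0 < 1 - S := by linarith [M.s_lt_one (Fin.last (n + 1))]
  have hsS : ∀ r, M.s r ≤ S := fun r => M.s_strictMono.monotone (Fin.le_last r)
  set C := 1 / (1 - D) + S / (1 - S) with hC
  have hC0 : 0 < C := by
    have : 0 < 1 - D := by linarith
    positivity
  -- With this `t`, `(1 - t) * oldGain D = -log (1 - D)`: a generation that carries debt `D` is
  -- still compensated when the gain of the old shrinks by the factor `1 - t`.
  set t := M.debtGain D / M.oldGain D with ht
  have ht0 : 0 < t := div_pos hgain hOG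
  have ht1 : t < 1 := by rw [ht, div_lt_one hOG]; unfold debtGain; linarith
  -- The ramp is flat enough for two purposes: supporting its debt lowers the log multiplier by at
  -- most the fraction `t`, and its slope in utility is at most one.
  obtain ⟨a, ha0, haC, haS⟩ : ∃ a, 0 < a ∧ C * a ≤ t ∧ S * a ≤ 1 - S := by
    refine ⟨min (t / C) ((1 - S) / S), lt_min (div_pos ht0 hC0) (div_pos hS1 hS0), ?_, ?_⟩
    · calc _ ≤ C * (t / C) := mul_le_mul_of_nonneg_left (min_le_left _ _) hC0.le
        _ = t := by field_simp
    · calc _ ≤ S * ((1 - S) / S) := mul_le_mul_of_nonneg_left (min_le_right _ _) hS0.le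
        _ = 1 - S := by field_simp
  have hdn : ∀ θ, 0 ≤ θ → 0 ≤ min (a * θ) D := fun θ hθ => le_min (mul_nonneg ha0.le hθ) hD0.le
  refine ⟨M.rampU a D, ⟨?_, ?_⟩, ?_, ?_, D / a, by positivity, ?_⟩
  · refine rampU_admissible ha0.le hD0.le fun r => ?_
    have := hsS r
    have := mul_le_mul_of_nonneg_right this ha0.le
    linarith
  · intro r θ hθ
    set d := min (a * θ) D with hd
    have hd0 : 0 ≤ d := hdn θ hθ
    have hdD : d ≤ D := min_le_right _ _
    obtain ⟨y, hy, hyC⟩ := exists_young_eq h r hd0 hdD hDlt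
    have hyC' : -(t * θ) ≤ y := by
      refine le_trans ?_ hyC
      have h1 : 1 / (1 - D) + M.s r / (1 - M.s r) ≤ C := by
        have := div_le_div₀ hS0.le (hsS r) hS1 (by linarith [hsS r] : 1 - S ≤ 1 - M.s r)
        linarith
      have h2 := mul_le_mul_of_nonneg_right h1 hd0
      have h3 : C * d ≤ C * (a * θ) := mul_le_mul_of_nonneg_left (min_le_left _ _) hC0.le
      have h4 := mul_le_mul_of_nonneg_right haC hθ
      linarith
    have hm : (1 - t) * θ ≤ θ + y := by linarith
    have hm0 : 0 ≤ (1 - t) * θ := mul_nonneg (by linarith) hθ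
    -- The log multiplier `θ + y` delivers exactly the debt `d`. As `θ + y ≥ (1 - t) θ`, next
    -- period's debt is at least `(1 - t) d`, and scaling the balance at `D` by `d / D` gives
    -- participation.
    refine ⟨θ + y, ⟨hm0.trans hm, ?_⟩, ?_⟩
    · rw [add_sub_cancel_left, hy, Real.log_mul (M.s_pos r).ne' (by linarith), autarky_eq]
      have hd' : (1 - t) * d ≤ min (a * (θ + y)) D := by
        refine le_min ?_ ?_
        · have := mul_le_mul_of_nonneg_left hm ha0.le
          have : (1 - t) * d ≤ (1 - t) * (a * θ) :=
            mul_le_mul_of_nonneg_left (min_le_left _ _) (by linarith)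
          linarith
        · nlinarith
      have h1 : M.oldGain ((1 - t) * d) ≤
          M.β * M.mean (fun r' => M.rampU a D r' (θ + y)) - M.β * M.mean M.wmin := by
        rw [← mul_sub, ← mean_sub]
        exact M.oldGain_mono (mul_nonneg (by linarith) hd0) hd'
      have hτ0 : 0 ≤ d / D := div_nonneg hd0 hD0.le
      have hτ1 : d / D ≤ 1 := (div_le_one hD0).2 hdD
      have h2 := log_concave_one hτ0 hτ1 hDlt
      have h3 := M.oldGain_concave (t := (1 - t) * (d / D)) (d := D)
        (mul_nonneg (by linarith) hτ0) (by nlinarith) hD0.le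
      rw [mul_assoc (1 - t) (d / D) D, div_mul_cancel₀ _ hD0.ne'] at h3
      rw [div_mul_cancel₀ _ hD0.ne'] at h2
      have h4 : (1 - t) * M.oldGain D = -Real.log (1 - D) := by
        have : t * M.oldGain D = M.debtGain D := div_mul_cancel₀ _ hOG.ne'
        unfold debtGain at this
        linarith
      have h5 : (1 - t) * (d / D) * M.oldGain D = d / D * -Real.log (1 - D) := by
        rw [← h4]; ring
      linarith
    · rw [add_sub_cancel_left]
      unfold oldU rampU promise
      rw [hy]
      apply le_of_eq
      congr 1; ring
  · intro r θ hθ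
    rw [← promise_zero]
    exact M.promise_le r le_rfl (hdn θ hθ)
  · intro r θ hθ
    rw [← promise_zero]
    exact M.promise_lt r le_rfl (lt_min (mul_pos ha0 hθ) hD0)
  -- At `D / a` the ramp has reached `D`, which exceeds the first-best debt of the highest share
  -- state.
  · have e : (fun r => M.rampU a D r (D / a)) = fun r => M.promise r D := by
      funext r
      unfold rampU
      rw [mul_div_cancel₀ _ ha0.ne', min_self]
    rw [e, autarky_eq]
    have h1 : M.oldGain D = M.β * M.mean (fun r => M.promise r D) - M.β * M.mean M.wmin := by
      unfold oldGain; rw [mean_sub, mul_sub]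
    have h2 : Real.log S + Real.log (1 - D) ≤ Real.log (M.young 0) := by
      rw [← Real.log_mul hS0.ne' (by linarith)]
      apply Real.log_le_log (mul_pos hS0 (by linarith))
      have : M.young 0 = S * (1 - dI) := by rw [hdI]; field_simp; ring
      rw [this]
      exact mul_le_mul_of_nonneg_left (by linarith) hS0.le
    unfold debtGain at hgain
    linarith

end

section

variable {n J : ℕ} (M : Economy n J)

/-! ### The solution of the recursion -/

/-- `W` solves the recursion, with the logarithm `N r θ` of the next multiplier. -/
structure Solution (W N : Fin (n + 2) → ℝ → ℝ) : Prop extends Admissible W where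
  N_nonneg : ∀ r θ, 0 ≤ θ → 0 ≤ N r θ
  N_mono : ∀ r θ θ', 0 ≤ θ → θ ≤ θ' → N r θ ≤ N r θ'
  N_lip : ∀ r θ θ', 0 ≤ θ → θ ≤ θ' → N r θ' ≤ N r θ + (θ' - θ)
  W_eq : ∀ r θ, 0 ≤ θ → W r θ = M.oldU (N r θ - θ)
  participation : ∀ r θ, 0 ≤ θ →
    M.autarky r ≤ Real.log (M.young (N r θ - θ)) + M.β * M.mean (fun r' => W r' (N r θ))
  binding : ∀ r θ, 0 ≤ θ → 0 < N r θ →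
    Real.log (M.young (N r θ - θ)) + M.β * M.mean (fun r' => W r' (N r θ)) = M.autarky r
  N_le : ∀ r θ m, 0 ≤ m →
    M.autarky r ≤ Real.log (M.young (m - θ)) + M.β * M.mean (fun r' => W r' m) → N r θ ≤ m
  wmin_le : ∀ r θ, 0 ≤ θ → M.wmin r ≤ W r θ
  wmin_lt : ∀ r θ, 0 < θ → M.wmin r < W r θ
  exists_large : ∃ Θ, 0 ≤ Θ ∧ M.autarky (Fin.last (n + 1)) ≤
      Real.log (M.young 0) + M.β * M.mean (fun r => W r Θ)

variable {M}

lemma exists_solution (h : M.Nonbinding) : ∃ W N, M.Solution W N := by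
  obtain ⟨L, hL, hL1, hL2, Θ, hΘ, hL3⟩ := exists_subsolution h
  have hne : M.subsolutions.Nonempty := ⟨L, hL⟩
  have ha := greatest_admissible hne
  have hf := greatest_feas_nonempty hne
  refine ⟨M.greatest, M.nextLog M.greatest,
    { toAdmissible := ha
      N_nonneg := fun r θ hθ => (nextLog_mem ha (hf r θ hθ)).1
      N_mono := fun r θ θ' hθ h => nextLog_mono ha hf r hθ h
      N_lip := fun r θ θ' hθ h => nextLog_lip ha hf r hθ h
      W_eq := fun r θ hθ => greatest_eq_update hne r hθ
      participation := fun r θ hθ => (nextLog_mem ha (hf r θ hθ)).2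
      binding := ?_
      N_le := fun r θ m hm hm' => nextLog_le ⟨hm, hm'⟩
      wmin_le := fun r θ hθ => (hL1 r θ hθ).trans (le_greatest hL r hθ)
      wmin_lt := fun r θ hθ => (hL2 r θ hθ).trans_le (le_greatest hL r hθ.le)
      exists_large := ⟨Θ, hΘ, hL3.trans ?_⟩ }⟩
  · intro r θ hθ hpos
    -- Slack at a positive least feasible point would, by continuity, make a slightly smaller one
    -- feasible.
    refine le_antisymm ?_ (nextLog_mem ha (hf r θ hθ)).2
    by_contra hc
    have hcont := (ha.participation_continuousOn (M := M) θ).continuousAt (Ici_mem_nhds hpos)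
    have hev := hcont.eventually (lt_mem_nhds (not_le.1 hc))
    obtain ⟨m, ⟨hm, hm0⟩, hm1⟩ := (((hev.and (lt_mem_nhds hpos)).filter_mono
      nhdsWithin_le_nhds).and (self_mem_nhdsWithin (s := Set.Iio (M.nextLog M.greatest r θ)))).exists
    have := nextLog_le (M := M) (W := M.greatest) (r := r) (θ := θ) ⟨hm0.le, hm.le⟩
    exact absurd hm1 (not_lt.2 this)
  · have := mul_le_mul_of_nonneg_left (M.mean_mono fun r => le_greatest hL r hΘ) M.β_pos.le
    linarith

namespace Solution

variable {W N : Fin (n + 2) → ℝ → ℝ}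

lemma mean_mono' (S : M.Solution W N) {m m' : ℝ} (hm : 0 ≤ m) (h : m ≤ m') :
    M.β * M.mean (fun r => W r m) ≤ M.β * M.mean (fun r => W r m') :=
  mul_le_mul_of_nonneg_left (M.mean_mono fun r => S.mono r m m' hm h) M.β_pos.le

lemma N_continuousOn (S : M.Solution W N) (r : Fin (n + 2)) :
    ContinuousOn (N r) (Set.Ici 0) :=
  Admissible.continuousOn ⟨S.N_mono, S.N_lip⟩ r

/-- Consumption does not exceed the endowment. -/
lemma young_le (S : M.Solution W N) (r : Fin (n + 2)) {θ : ℝ} (hθ : 0 ≤ θ) :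
    M.young (N r θ - θ) ≤ M.s r := by
  have h := S.wmin_le r θ hθ
  rw [S.W_eq r θ hθ] at h
  have := (Real.log_le_log_iff (by linarith [M.s_lt_one r]) (M.one_sub_young_pos _)).1 h
  linarith

/-- Otherwise first-best consumption would satisfy participation with promises no larger than the
first-best utility of the old, which is excluded. -/
lemma last_zero_pos (h : M.Nonbinding) (S : M.Solution W N) : 0 < N (Fin.last (n + 1)) 0 := by
  rcases (S.N_nonneg (Fin.last (n + 1)) 0 le_rfl).lt_or_eq with h0 | h0
  · exact h0
  · have h1 := S.participation (Fin.last (n + 1)) 0 le_rfl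
    rw [← h0, sub_zero] at h1
    have h2 := mul_le_mul_of_nonneg_left (M.mean_mono (φ := fun r => W r 0)
      (φ' := fun _ => M.oldU 0) fun r => by
        rw [S.W_eq r 0 le_rfl]
        exact M.oldU_strictAnti.antitone (by linarith [S.N_nonneg r 0 le_rfl])) M.β_pos.le
    rw [mean_const] at h2
    linarith [h.no_first_best]

/-- If the old received only autarky here, the young would consume their whole endowment and still
expect promises strictly above autarky; but participation binds because the multiplier is positive.
-/
lemma wmin_lt_last (h : M.Nonbinding) (S : M.Solution W N) :
    M.wmin (Fin.last (n + 1)) < W (Fin.last (n + 1)) 0 := by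
  refine lt_of_le_of_ne (S.wmin_le _ 0 le_rfl) fun heq => ?_
  have hpos := S.last_zero_pos h
  have hb := S.binding _ 0 le_rfl hpos
  have hc : M.young (N (Fin.last (n + 1)) 0 - 0) = M.s (Fin.last (n + 1)) := by
    rw [S.W_eq _ 0 le_rfl] at heq
    have := Real.log_injOn_pos (by simpa using M.s_lt_one _) (M.one_sub_young_pos _) heq
    linarith
  rw [hc, autarky_eq] at hb
  have := M.mean_lt (fun r => (S.wmin_lt r _ hpos).le) 0 (S.wmin_lt 0 _ hpos)
  have := mul_lt_mul_of_pos_left this M.β_pos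
  linarith

/-- In the lowest share state the multiplier is reset. -/
lemma exists_reset (h : M.Nonbinding) (S : M.Solution W N) :
    ∃ ε, 0 < ε ∧ ∀ θ, 0 ≤ θ → N 0 θ ≤ max 0 (θ - ε) := by
  -- At `θ = m = 0` the young consume `s 0`, and the promise in the highest share state strictly
  -- exceeds autarky. The slack persists for small `θ`; the Lipschitz bound on `N` carries the
  -- decrease to all larger `θ`.
  have hlt : M.autarky 0 < Real.log (M.young (0 - 0)) + M.β * M.mean (fun r => W r 0) := by
    have := M.mean_lt (fun r => S.wmin_le r 0 le_rfl) _ (S.wmin_lt_last h)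
    have := mul_lt_mul_of_pos_left this M.β_pos
    rw [autarky_eq, sub_zero, h.s_zero]
    linarith
  have hcont : Continuous fun θ : ℝ =>
      Real.log (M.young (0 - θ)) + M.β * M.mean (fun r => W r 0) :=
    (M.log_young_continuous.comp (continuous_const.sub continuous_id)).add continuous_const
  have hev := hcont.continuousAt.eventually (lt_mem_nhds hlt)
  obtain ⟨ε, hε, hε0⟩ := ((hev.filter_mono nhdsWithin_le_nhds).and
    (self_mem_nhdsWithin (s := Set.Ioi (0 : ℝ)))).exists
  have hN : N 0 ε ≤ 0 := S.N_le 0 ε 0 le_rfl hε.le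
  refine ⟨ε, hε0, fun θ hθ => ?_⟩
  rcases le_total θ ε with hle | hle
  · exact ((S.N_mono 0 θ ε hθ hle).trans hN).trans (le_max_left _ _)
  · have := S.N_lip 0 ε θ (le_of_lt hε0) hle
    exact le_trans (by linarith) (le_max_right _ _)

lemma zero_zero (h : M.Nonbinding) (S : M.Solution W N) : N 0 0 = 0 := by
  obtain ⟨ε, hε, hr⟩ := S.exists_reset h
  have := hr 0 le_rfl
  rw [max_eq_left (by linarith)] at this
  exact le_antisymm this (S.N_nonneg 0 0 le_rfl)

lemma zero_lt (h : M.Nonbinding) (S : M.Solution W N) {θ : ℝ} (hθ : 0 < θ) : N 0 θ < θ := by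
  obtain ⟨ε, hε, hr⟩ := S.exists_reset h
  exact (hr θ hθ.le).trans_lt (max_lt hθ (by linarith))

/-- After finitely many dates in the lowest share state the multiplier is one. -/
lemma exists_iterate_zero (h : M.Nonbinding) (S : M.Solution W N) (Θ : ℝ) :
    ∃ K : ℕ, ∀ θ, 0 ≤ θ → θ ≤ Θ → (N 0)^[K] θ = 0 := by
  obtain ⟨ε, hε, hr⟩ := S.exists_reset h
  obtain ⟨K, hK⟩ := exists_nat_gt (Θ / ε)
  rw [div_lt_iff₀ hε] at hK
  refine ⟨K, fun θ hθ hle => ?_⟩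
  have key : ∀ k : ℕ, 0 ≤ (N 0)^[k] θ ∧ (N 0)^[k] θ ≤ max 0 (θ - k * ε) := by
    intro k
    induction k with
    | zero => simp [hθ]
    | succ k ih =>
      rw [Function.iterate_succ_apply']
      refine ⟨S.N_nonneg 0 _ ih.1, (hr _ ih.1).trans (max_le (le_max_left _ _) ?_)⟩
      rcases le_max_iff.1 ih.2 with h1 | h1
      · exact le_trans (by linarith) (le_max_left _ _)
      · refine le_trans ?_ (le_max_right _ _)
        push_cast; linarith
  have := (key K).2
  rw [max_eq_left (by linarith)] at this
  exact le_antisymm this (key K).1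

/-- If `W` is constant on an interval, then the next multipliers span an interval of the same
length, on which `W` is constant in every share state. -/
lemma flat_step (S : M.Solution W N) {r : Fin (n + 2)} {θ θ' : ℝ} (hθ : 0 ≤ θ)
    (hlt : θ < θ') (heq : W r θ = W r θ') :
    N r θ' - N r θ = θ' - θ ∧ ∀ r', W r' (N r θ) = W r' (N r θ') := by
  have hθ' : 0 ≤ θ' := hθ.trans hlt.le
  have e : N r θ - θ = N r θ' - θ' := by
    rw [S.W_eq r θ hθ, S.W_eq r θ' hθ'] at heq
    exact M.oldU_strictAnti.injective heq
  refine ⟨by linarith, ?_⟩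
  have hN := S.N_nonneg r θ hθ
  have hmono : ∀ r', W r' (N r θ) ≤ W r' (N r θ') := fun r' => S.mono r' _ _ hN (by linarith)
  -- Consumption is the same at both ends and participation binds at the upper one, so expected
  -- promises cannot rise; by monotonicity none of them does.
  have h1 := S.binding r θ' hθ' (by linarith)
  have h2 := S.participation r θ hθ
  rw [e] at h2
  by_contra hc
  push Not at hc
  obtain ⟨r', hr'⟩ := hc
  have := mul_lt_mul_of_pos_left (M.mean_lt hmono r' (lt_of_le_of_ne (hmono r') hr')) M.β_pos
  linarith

/-- A flat interval would be carried forward with its length intact. Along repeated lowest shares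
its upper end is reset to zero, which leaves no room for a positive length. -/
lemma W_strictMono (h : M.Nonbinding) (S : M.Solution W N) (r : Fin (n + 2)) {θ θ' : ℝ}
    (hθ : 0 ≤ θ) (hlt : θ < θ') : W r θ < W r θ' := by
  refine lt_of_le_of_ne (S.mono r θ θ' hθ hlt.le) fun heq => ?_
  have key : ∀ k : ℕ, ∀ a b, 0 ≤ a → a < b → W 0 a = W 0 b →
      b - a ≤ (N 0)^[k] b := by
    intro k
    induction k with
    | zero => intro a b ha hab _; simpa using ha
    | succ k ih =>
      intro a b ha hab hw
      obtain ⟨h1, h2⟩ := S.flat_step ha hab hw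
      rw [Function.iterate_succ_apply, ← h1]
      exact ih _ _ (S.N_nonneg 0 a ha) (by linarith) (h2 0)
  obtain ⟨h1, h2⟩ := S.flat_step hθ hlt heq
  have hN := S.N_nonneg r θ hθ
  obtain ⟨K, hK⟩ := S.exists_iterate_zero h (N r θ')
  have := key K _ _ hN (by linarith) (h2 0)
  rw [hK _ (by linarith) le_rfl] at this
  linarith

lemma W_le_iff (h : M.Nonbinding) (S : M.Solution W N) (r : Fin (n + 2)) {θ θ' : ℝ}
    (hθ : 0 ≤ θ) (hθ' : 0 ≤ θ') : W r θ ≤ W r θ' ↔ θ ≤ θ' :=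
  ⟨fun hle => by
    by_contra hc
    exact absurd hle (not_le.2 (S.W_strictMono h r hθ' (not_le.1 hc))),
   fun hle => S.mono r θ θ' hθ hle⟩

end Solution

/-! ### The long-run range of the multiplier. -/

variable (M) in
/-- The largest logarithm of the multiplier in the long run, given the utilities `W`. -/
def cap (W : Fin (n + 2) → ℝ → ℝ) : ℝ :=
  sInf {θ | 0 ≤ θ ∧ M.autarky (Fin.last (n + 1)) ≤
    Real.log (M.young 0) + M.β * M.mean (fun r => W r θ)}

namespace Solution

variable {W N : Fin (n + 2) → ℝ → ℝ}

lemma cap_mem (S : M.Solution W N) : 0 ≤ M.cap W ∧ M.autarky (Fin.last (n + 1)) ≤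
    Real.log (M.young 0) + M.β * M.mean (fun r => W r (M.cap W)) := by
  have hcl : IsClosed {θ | 0 ≤ θ ∧ M.autarky (Fin.last (n + 1)) ≤
      Real.log (M.young 0) + M.β * M.mean (fun r => W r θ)} :=
    (continuousOn_const.add (continuousOn_const.mul
      (S.toAdmissible.mean_continuousOn (M := M)))).preimage_isClosed_of_isClosed isClosed_Ici
      (isClosed_Ici (a := M.autarky (Fin.last (n + 1))))
  exact hcl.csInf_mem S.exists_large ⟨0, fun m hm => hm.1⟩

lemma cap_le {θ : ℝ} (hθ : 0 ≤ θ) (h : M.autarky (Fin.last (n + 1)) ≤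
    Real.log (M.young 0) + M.β * M.mean (fun r => W r θ)) : M.cap W ≤ θ :=
  csInf_le ⟨0, fun _ h => h.1⟩ ⟨hθ, h⟩

/-- At `max θ cap` consumption is at least first best and promises are at least those at `cap`,
which suffices even for the highest share, where autarky is most attractive. -/
lemma N_le_max (S : M.Solution W N) (r : Fin (n + 2)) (θ : ℝ) :
    N r θ ≤ max θ (M.cap W) := by
  have h0 := S.cap_mem
  refine S.N_le r θ _ (h0.1.trans (le_max_right _ _)) ((M.autarky_mono (Fin.le_last r)).trans
    (h0.2.trans ?_))
  have h1 := M.log_young_strictMono.monotone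
    (by linarith [le_max_left θ (M.cap W)] : 0 ≤ max θ (M.cap W) - θ)
  have h2 := S.mean_mono' h0.1 (le_max_right θ (M.cap W))
  exact add_le_add h1 h2

lemma N_le_cap (S : M.Solution W N) (r : Fin (n + 2)) {θ : ℝ} (hθ : θ ≤ M.cap W) :
    N r θ ≤ M.cap W := (S.N_le_max r θ).trans (max_le hθ le_rfl)

/-- In the highest share state the multiplier increases. -/
lemma le_N_last (S : M.Solution W N) {θ : ℝ} (h0 : 0 ≤ θ) (hθ : θ ≤ M.cap W) :
    θ ≤ N (Fin.last (n + 1)) θ := by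
  by_contra hc
  have hlt := not_le.1 hc
  have hN := S.N_nonneg (Fin.last (n + 1)) θ h0
  have h1 := S.participation (Fin.last (n + 1)) θ h0
  have h2 : Real.log (M.young (N (Fin.last (n + 1)) θ - θ)) < Real.log (M.young 0) :=
    M.log_young_strictMono (by linarith)
  have := cap_le (M := M) hN (by linarith)
  linarith

lemma N_last_cap (S : M.Solution W N) : N (Fin.last (n + 1)) (M.cap W) = M.cap W :=
  le_antisymm (S.N_le_cap _ le_rfl) (S.le_N_last S.cap_mem.1 le_rfl)

lemma cap_pos (h : M.Nonbinding) (S : M.Solution W N) : 0 < M.cap W :=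
  (S.last_zero_pos h).trans_le (S.N_le_cap _ S.cap_mem.1)

lemma iterate_last_mem (S : M.Solution W N) (k : ℕ) :
    0 ≤ (N (Fin.last (n + 1)))^[k] 0 ∧ (N (Fin.last (n + 1)))^[k] 0 ≤ M.cap W := by
  induction k with
  | zero => exact ⟨le_rfl, S.cap_mem.1⟩
  | succ k ih =>
    rw [Function.iterate_succ_apply']
    exact ⟨S.N_nonneg _ _ ih.1, S.N_le_cap _ ih.2⟩

/-- The increasing iterates converge to a fixed point. There consumption is first best and
participation holds, so the limit belongs to the set whose infimum is `cap`. -/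
lemma tendsto_iterate_last (S : M.Solution W N) :
    Tendsto (fun k => (N (Fin.last (n + 1)))^[k] 0) atTop (𝓝 (M.cap W)) := by
  have hmono : Monotone fun k => (N (Fin.last (n + 1)))^[k] 0 := by
    refine monotone_nat_of_le_succ fun k => ?_
    rw [Function.iterate_succ_apply']
    exact S.le_N_last (S.iterate_last_mem k).1 (S.iterate_last_mem k).2
  have hlim := tendsto_atTop_ciSup hmono ⟨M.cap W, by
    rintro _ ⟨k, rfl⟩; exact (S.iterate_last_mem k).2⟩
  set L := ⨆ k, (N (Fin.last (n + 1)))^[k] 0 with hL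
  have hL0 : 0 ≤ L := ge_of_tendsto' hlim fun k => (S.iterate_last_mem k).1
  have hL1 : L ≤ M.cap W := le_of_tendsto' hlim fun k => (S.iterate_last_mem k).2
  have hfix : N (Fin.last (n + 1)) L = L := by
    have h1 : Tendsto (fun k => N (Fin.last (n + 1)) ((N (Fin.last (n + 1)))^[k] 0)) atTop
        (𝓝 (N (Fin.last (n + 1)) L)) :=
      (S.N_continuousOn (Fin.last (n + 1)) L hL0).tendsto.comp
        (tendsto_nhdsWithin_iff.2 ⟨hlim, Eventually.of_forall fun k => (S.iterate_last_mem k).1⟩)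
    have h2 := hlim.comp (tendsto_add_atTop_nat 1)
    refine tendsto_nhds_unique h1 (h2.congr fun k => ?_)
    simp only [Function.comp_apply]
    rw [Function.iterate_succ_apply']
  have h1 := S.participation (Fin.last (n + 1)) L hL0
  rw [hfix, sub_self] at h1
  rw [le_antisymm (cap_le hL0 h1) hL1]
  exact hlim

lemma promise_debt (r : Fin (n + 2)) (y : ℝ) :
    M.promise r (1 - M.young y / M.s r) = M.oldU y := by
  have := (M.s_pos r).ne'
  unfold promise oldU
  congr 1
  field_simp; ring

/-- The debt limit does not bind. -/
lemma W_le (h : M.Nonbinding) (S : M.Solution W N) (r : Fin (n + 2)) {θ : ℝ} (hθ : 0 ≤ θ) :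
    W r θ ≤ M.wmax r := by
  set Θ := max θ (M.cap W) with hΘ
  have hΘ0 : 0 ≤ Θ := hθ.trans (le_max_left _ _)
  set D : Fin (n + 2) → ℝ := fun r => 1 - M.young (N r Θ - Θ) / M.s r with hD
  have hWD : ∀ r, W r Θ = M.promise r (D r) := fun r => by
    rw [S.W_eq r Θ hΘ0, hD, promise_debt]
  have hD0 : ∀ r, 0 ≤ D r := fun r => by
    have := (div_le_one (M.s_pos r)).2 (S.young_le r hΘ0)
    simp only [hD]; linarith
  -- Take the share state with the highest debt at `Θ`. As `Θ ≥ cap`, the multiplier does not rise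
  -- from there, so no debt at the next date exceeds `D q`. Participation then makes `debtGain (D
  -- q)` nonnegative.
  obtain ⟨q, -, hq⟩ := Finset.exists_max_image Finset.univ D ⟨0, Finset.mem_univ _⟩
  have hq1 : D q < 1 := by
    have := div_pos (M.young_pos (N q Θ - Θ)) (M.s_pos q)
    simp only [hD]; linarith
  have hqmax : D q ≤ M.dmax := by
    refine M.le_dmax h.dmax_pos hq1 ?_
    have h1 := S.participation q Θ hΘ0
    have h2 := S.mean_mono' (S.N_nonneg q Θ hΘ0)
      ((S.N_le_max q Θ).trans (max_le le_rfl (le_max_right _ _)))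
    have h3 : Real.log (1 - D q) = Real.log (M.young (N q Θ - Θ)) - Real.log (M.s q) := by
      rw [← Real.log_div (M.young_pos _).ne' (M.s_pos q).ne', hD]
      congr 1; ring
    have h4 : M.β * M.mean (fun r => W r Θ) - M.β * M.mean M.wmin ≤ M.oldGain (D q) := by
      rw [← mul_sub, ← mean_sub]
      refine mul_le_mul_of_nonneg_left (M.mean_mono fun r => ?_) M.β_pos.le
      have := M.promise_le r (hD0 r) (hq r (Finset.mem_univ _))
      rw [hWD]; linarith
    rw [autarky_eq] at h1
    unfold debtGain
    linarith
  calc W r θ ≤ W r Θ := S.mono r θ Θ hθ (le_max_left _ _)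
    _ = M.promise r (D r) := hWD r
    _ ≤ M.promise r M.dmax := M.promise_le r (hD0 r) ((hq r (Finset.mem_univ _)).trans hqmax)

end Solution

end

section

variable {n J : ℕ} (M : Economy n J)

/-! ### Payoffs of sustainable rules -/

/-- Conditional expectation, after a history, of a function of the next history. -/
def expNext (φ : Hist n J → ℝ) (h : Hist n J) : ℝ :=
  ∑ ρ : Fin (n + 2) × Fin J, M.π ρ.1 * M.ς ρ.2 * φ (ρ :: h)

lemma sum_shocks (φ : Fin (n + 2) → ℝ) :
    ∑ ρ : Fin (n + 2) × Fin J, M.π ρ.1 * M.ς ρ.2 * φ ρ.1 = M.mean φ := by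
  rw [Fintype.sum_prod_type]
  refine Finset.sum_congr rfl fun r _ => ?_
  simp only
  rw [← Finset.sum_mul, ← Finset.mul_sum, M.ς_sum, mul_one]

lemma expNext_share (φ : Fin (n + 2) → ℝ) (ψ : Hist n J → ℝ) (h : Hist n J)
    (e : ∀ ρ, ψ (ρ :: h) = φ ρ.1) : M.expNext ψ h = M.mean φ := by
  simp only [expNext, e, sum_shocks]

lemma expNext_mono {φ φ' : Hist n J → ℝ} (h : Hist n J)
    (hle : ∀ ρ, φ (ρ :: h) ≤ φ' (ρ :: h)) : M.expNext φ h ≤ M.expNext φ' h :=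
  Finset.sum_le_sum fun ρ _ =>
    mul_le_mul_of_nonneg_left (hle ρ) (mul_pos (M.π_pos ρ.1) (M.ς_pos ρ.2)).le

lemma expNext_add (φ φ' : Hist n J → ℝ) (h : Hist n J) :
    M.expNext (fun h => φ h + φ' h) h = M.expNext φ h + M.expNext φ' h := by
  simp only [expNext, mul_add, Finset.sum_add_distrib]

lemma expNext_mul_left (a : ℝ) (φ : Hist n J → ℝ) (h : Hist n J) :
    M.expNext (fun k => a * φ k) h = a * M.expNext φ h := by
  simp only [expNext, Finset.mul_sum]
  exact Finset.sum_congr rfl fun _ _ => by ring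

lemma expNext_const (a : ℝ) (h : Hist n J) : M.expNext (fun _ => a) h = a := by
  rw [M.expNext_share (fun _ => a) _ h fun _ => rfl, mean_const]

lemma expPayoff_succ (c : Hist n J → ℝ) (t : ℕ) (h : Hist n J) :
    M.expPayoff c (t + 1) h = M.expNext (M.expPayoff c t) h := rfl

lemma gain_eq (i : Fin (n + 2)) (c : Hist n J → ℝ) (h : Hist n J) :
    M.gain i c h = Real.log (c h) + M.β * M.expNext (fun h => Real.log (1 - c h)) h -
      M.autarky (curShare i h) := by
  have h1 : ∑ ρ : Fin (n + 2) × Fin J, M.π ρ.1 * M.ς ρ.2 *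
      (Real.log (1 - c (ρ :: h)) - Real.log (1 - M.s ρ.1)) =
      M.expNext (fun h => Real.log (1 - c h)) h - M.mean M.wmin := by
    simp only [mul_sub, Finset.sum_sub_distrib]
    rw [M.sum_shocks (fun r => Real.log (1 - M.s r))]
    rfl
  unfold gain
  rw [h1, autarky_eq]
  ring

lemma Sustainable.lt_one {M : Economy n J} {i : Fin (n + 2)} {c : Hist n J → ℝ}
    (hc : M.Sustainable i c) (h : Hist n J) : c h < 1 :=
  (hc h).2.1.trans_lt (M.s_lt_one _)

lemma Sustainable.log_one_sub {M : Economy n J} {i : Fin (n + 2)} {c : Hist n J → ℝ}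
    (hc : M.Sustainable i c) (h : Hist n J) :
    M.wmin (Fin.last (n + 1)) ≤ Real.log (1 - c h) ∧ Real.log (1 - c h) ≤ 0 := by
  have h1 := (hc h).2.1.trans (M.s_strictMono.monotone (Fin.le_last _))
  have h2 := M.s_lt_one (Fin.last (n + 1))
  have h3 := (hc h).1
  exact ⟨Real.log_le_log (by linarith) (by linarith),
    Real.log_nonpos (by linarith) (by linarith)⟩

/-- The old have utility at most zero, so participation alone keeps the consumption of the young
away from zero. -/
lemma Sustainable.autarky_le_log {M : Economy n J} {i : Fin (n + 2)} {c : Hist n J → ℝ}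
    (hc : M.Sustainable i c) (h : Hist n J) : M.autarky 0 ≤ Real.log (c h) := by
  have h1 := (hc h).2.2
  rw [gain_eq] at h1
  have h2 := M.expNext_mono (φ := fun h => Real.log (1 - c h)) (φ' := fun _ => 0) h fun ρ => (hc.log_one_sub (ρ :: h)).2
  rw [expNext_const] at h2
  have h3 := M.autarky_mono (Fin.zero_le (curShare i h))
  nlinarith [M.β_pos]

/-- Bound on the payoffs of sustainable rules. -/
def payoffBound : ℝ := -(M.β / M.δ * M.wmin (Fin.last (n + 1)) + M.autarky 0)

lemma Sustainable.expPayoff_bound {M : Economy n J} {i : Fin (n + 2)} {c : Hist n J → ℝ}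
    (hc : M.Sustainable i c) (t : ℕ) (h : Hist n J) :
    -M.payoffBound ≤ M.expPayoff c t h ∧ M.expPayoff c t h ≤ 0 := by
  induction t generalizing h with
  | zero =>
    have h1 := hc.log_one_sub h
    have h2 := hc.autarky_le_log h
    have h3 := Real.log_nonpos (hc h).1.le (hc.lt_one h).le
    have hq := div_pos M.β_pos M.δ_pos
    have h4 := mul_le_mul_of_nonneg_left h1.1 hq.le
    have h5 := mul_nonpos_of_nonneg_of_nonpos hq.le h1.2
    unfold payoffBound
    simp only [expPayoff]
    constructor <;> linarith
  | succ t ih =>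
    rw [expPayoff_succ]
    constructor
    · rw [← M.expNext_const (-M.payoffBound) h]
      exact M.expNext_mono h fun ρ => (ih (ρ :: h)).1
    · rw [← M.expNext_const 0 h]
      exact M.expNext_mono h fun ρ => (ih (ρ :: h)).2

/-- Payoff from the first `T` dates. -/
def partialPayoff (c : Hist n J → ℝ) (T : ℕ) (h : Hist n J) : ℝ :=
  ∑ t ∈ Finset.range T, M.δ ^ t * M.expPayoff c t h

lemma partialPayoff_succ (c : Hist n J → ℝ) (T : ℕ) (h : Hist n J) :
    M.partialPayoff c (T + 1) h = M.β / M.δ * Real.log (1 - c h) + Real.log (c h) +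
      M.δ * M.expNext (M.partialPayoff c T) h := by
  unfold partialPayoff
  rw [Finset.sum_range_succ', add_comm]
  simp only [expNext, Finset.mul_sum, pow_zero, one_mul]
  congr 1
  rw [Finset.sum_comm]
  refine Finset.sum_congr rfl fun t _ => ?_
  rw [expPayoff_succ, expNext, Finset.mul_sum]
  exact Finset.sum_congr rfl fun ρ _ => by ring

lemma Sustainable.tendsto_partialPayoff {M : Economy n J} {i : Fin (n + 2)} {c : Hist n J → ℝ}
    (hc : M.Sustainable i c) :
    Tendsto (fun T => M.partialPayoff c T []) atTop (𝓝 (M.payoff c)) := by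
  have hs : Summable fun t : ℕ => M.δ ^ t * M.expPayoff c t [] := by
    refine Summable.of_norm_bounded
      ((summable_geometric_of_lt_one M.δ_pos.le M.δ_lt_one).mul_right M.payoffBound) fun t => ?_
    have h1 := hc.expPayoff_bound t []
    rw [norm_mul, Real.norm_of_nonneg (pow_nonneg M.δ_pos.le t)]
    refine mul_le_mul_of_nonneg_left ?_ (pow_nonneg M.δ_pos.le t)
    exact abs_le.2 ⟨h1.1, h1.2.trans (by linarith)⟩
  exact hs.hasSum.tendsto_sum_nat

lemma Sustainable.payoff_nonpos {M : Economy n J} {i : Fin (n + 2)} {c : Hist n J → ℝ}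
    (hc : M.Sustainable i c) : M.payoff c ≤ 0 :=
  tsum_nonpos fun t => mul_nonpos_of_nonneg_of_nonpos (pow_nonneg M.δ_pos.le t)
    (hc.expPayoff_bound t []).2

/-! ### Constant debt is sustainable -/

/-- It shows that every promise up to `wmax` can be met, so that suprema defining `value` are over
nonempty sets. -/
lemma sustainable_constant_debt (h : M.Nonbinding) (i : Fin (n + 2)) :
    M.Sustainable i fun h => M.s (curShare i h) * (1 - M.dmax) := by
  have hd := M.dmax_spec h.dmax_pos
  intro k
  have hs := M.s_pos (curShare i k)
  refine ⟨mul_pos hs (by linarith), by nlinarith [h.dmax_pos], ?_⟩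
  rw [gain_eq, M.expNext_share M.wmax]
  · have h1 : M.oldGain M.dmax = M.β * M.mean M.wmax - M.β * M.mean M.wmin := by
      unfold oldGain; rw [mean_sub, mul_sub]; rfl
    have h2 := hd.2
    unfold debtGain at h2
    rw [Real.log_mul hs.ne' (by linarith), autarky_eq]
    linarith
  · intro ρ
    change Real.log (1 - M.s ρ.1 * (1 - M.dmax)) = Real.log (1 - M.s ρ.1 + M.s ρ.1 * M.dmax)
    congr 1; ring

lemma one_sub_constant_debt (i : Fin (n + 2)) :
    Real.log (1 - M.s i * (1 - M.dmax)) = M.wmax i := by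
  unfold wmax promise; congr 1; ring

/-! ### The rule generated by the multipliers -/

variable {M}

/-- The logarithm of the previous multiplier. -/
def logMult (N : Fin (n + 2) → ℝ → ℝ) (i : Fin (n + 2)) (θ : ℝ) : Hist n J → ℝ
  | [] => θ
  | _ :: h => N (curShare i h) (logMult N i θ h)

variable (M) in
/-- The rule generated by the multipliers, from the share state `i` and multiplier `exp θ`. -/
def multRule (N : Fin (n + 2) → ℝ → ℝ) (i : Fin (n + 2)) (θ : ℝ) (h : Hist n J) : ℝ :=
  M.young (N (curShare i h) (logMult N i θ h) - logMult N i θ h)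

/-- `log` is concave: comparison of weighted sums of logarithms of two shares. -/
lemma weighted_logs_lt {A B x y : ℝ} (hA : 0 < A) (hB : 0 < B) (hx : 0 < x) (hx1 : x < 1)
    (hy : 0 < y) (hy1 : y < 1) (hne : x ≠ y) (h : (y - x) * (A * y - B * (1 - y)) ≤ 0) :
    A * Real.log (1 - x) + B * Real.log x < A * Real.log (1 - y) + B * Real.log y := by
  have hx' : 0 < 1 - x := by linarith
  have hy' : 0 < 1 - y := by linarith
  have h1 : Real.log (1 - x) - Real.log (1 - y) ≤ (1 - x) / (1 - y) - 1 := by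
    rw [← Real.log_div hx'.ne' hy'.ne']
    exact Real.log_le_sub_one_of_pos (div_pos hx' hy')
  have h2 : Real.log x - Real.log y < x / y - 1 := by
    rw [← Real.log_div hx.ne' hy.ne']
    exact Real.log_lt_sub_one_of_pos (div_pos hx hy) fun e => hne ((div_eq_one_iff_eq hy.ne').1 e)
  have h3 := mul_le_mul_of_nonneg_left h1 hA.le
  have h4 := mul_lt_mul_of_pos_left h2 hB
  have h5 : A * ((1 - x) / (1 - y) - 1) + B * (x / y - 1) =
      (y - x) * (A * y - B * (1 - y)) / (y * (1 - y)) := by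
    field_simp; ring
  have h6 : (y - x) * (A * y - B * (1 - y)) / (y * (1 - y)) ≤ 0 :=
    div_nonpos_of_nonpos_of_nonneg h (mul_pos hy hy').le
  linarith

lemma weighted_logs_le {A B x y : ℝ} (hA : 0 < A) (hB : 0 < B) (hx : 0 < x) (hx1 : x < 1)
    (hy : 0 < y) (hy1 : y < 1) (h : (y - x) * (A * y - B * (1 - y)) ≤ 0) :
    A * Real.log (1 - x) + B * Real.log x ≤ A * Real.log (1 - y) + B * Real.log y := by
  rcases eq_or_ne x y with rfl | hne
  · exact le_rfl
  · exact (weighted_logs_lt hA hB hx hx1 hy hy1 hne h).le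

lemma young_lt_one (y : ℝ) : M.young y < 1 := by linarith [M.one_sub_young_pos y]

/-- First-order condition for the consumption of the young. -/
lemma young_foc (p m : ℝ) :
    M.β / M.δ * Real.exp p * M.young (m - p) = Real.exp m * (1 - M.young (m - p)) := by
  rw [one_sub_young, young]
  have := M.den_pos (m - p)
  have := M.δ_pos
  have : Real.exp m = Real.exp p * Real.exp (m - p) := by rw [← Real.exp_add]; ring_nf
  rw [this]
  field_simp

/-! ### Weak duality for sustainable rules. -/

namespace Solution

variable {W N : Fin (n + 2) → ℝ → ℝ}

lemma logMult_mem (S : M.Solution W N) (i : Fin (n + 2)) {θ : ℝ} (hθ : 0 ≤ θ)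
    (h : Hist n J) : 0 ≤ logMult N i θ h ∧ logMult N i θ h ≤ max θ (M.cap W) := by
  induction h with
  | nil => exact ⟨hθ, le_max_left _ _⟩
  | cons ρ h ih =>
    exact ⟨S.N_nonneg _ _ ih.1, (S.N_le_max _ _).trans (max_le ih.2 (le_max_right _ _))⟩

lemma log_one_sub_multRule (S : M.Solution W N) (i : Fin (n + 2)) {θ : ℝ} (hθ : 0 ≤ θ)
    (h : Hist n J) : Real.log (1 - M.multRule N i θ h) = W (curShare i h) (logMult N i θ h) :=
  (S.W_eq _ _ (S.logMult_mem i hθ h).1).symm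

lemma gain_multRule (S : M.Solution W N) (i : Fin (n + 2)) {θ : ℝ} (hθ : 0 ≤ θ)
    (h : Hist n J) : M.gain i (M.multRule N i θ) h =
      Real.log (M.young (N (curShare i h) (logMult N i θ h) - logMult N i θ h)) +
        M.β * M.mean (fun r => W r (N (curShare i h) (logMult N i θ h))) -
        M.autarky (curShare i h) := by
  rw [gain_eq, M.expNext_share (fun r => W r (N (curShare i h) (logMult N i θ h)))]
  · rfl
  · intro ρ
    rw [S.log_one_sub_multRule i hθ]
    rfl

lemma multRule_sustainable (S : M.Solution W N) (i : Fin (n + 2)) {θ : ℝ} (hθ : 0 ≤ θ) :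
    M.Sustainable i (M.multRule N i θ) := by
  intro h
  have hm := S.logMult_mem i hθ h
  refine ⟨M.young_pos _, S.young_le _ hm.1, ?_⟩
  rw [S.gain_multRule i hθ]
  linarith [S.participation (curShare i h) _ hm.1]

/-- One step of the comparison of a sustainable rule with the rule generated by the
multipliers. -/
lemma lagrangian_step (S : M.Solution W N) {i : Fin (n + 2)} {θ : ℝ} (hθ : 0 ≤ θ)
    {c : Hist n J → ℝ} (hc : M.Sustainable i c) (h : Hist n J) {p m : ℝ}
    (hp : p = logMult N i θ h) (hm : m = N (curShare i h) p) :
    (M.β / M.δ * Real.log (1 - c h) + Real.log (c h)) +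
      M.β / M.δ * (Real.exp p - 1) * Real.log (1 - c h) -
      M.β * (Real.exp m - 1) * M.expNext (fun h => Real.log (1 - c h)) h -
      (M.β / M.δ * Real.exp p * Real.log (1 - c h) + Real.exp m * Real.log (c h)) ≤
    (M.β / M.δ * Real.log (1 - M.multRule N i θ h) + Real.log (M.multRule N i θ h)) +
      M.β / M.δ * (Real.exp p - 1) * Real.log (1 - M.multRule N i θ h) -
      M.β * (Real.exp m - 1) * M.expNext (fun h => Real.log (1 - M.multRule N i θ h)) h -
      (M.β / M.δ * Real.exp p * Real.log (1 - M.multRule N i θ h) +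
        Real.exp m * Real.log (M.multRule N i θ h)) := by
  have hp0 : 0 ≤ p := hp ▸ (S.logMult_mem i hθ h).1
  have hm0 : 0 ≤ m := hm ▸ S.N_nonneg _ _ hp0
  have hm1 : 0 ≤ Real.exp m - 1 := by linarith [Real.one_le_exp hm0]
  have h1 := mul_nonneg hm1 (hc h).2.2
  -- Complementary slackness along the generated path.
  have h2 : (Real.exp m - 1) * M.gain i (M.multRule N i θ) h = 0 := by
    rcases hm0.lt_or_eq with hpos | h0
    · rw [S.gain_multRule i hθ, ← hp, ← hm]
      have := S.binding (curShare i h) p hp0 (hm ▸ hpos)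
      rw [← hm] at this
      rw [this, sub_self, mul_zero]
    · rw [← h0]; simp
  rw [gain_eq] at h1 h2
  linarith

/-- The Lagrangian of the first `T` dates. -/
lemma partialPayoff_le (S : M.Solution W N) {i : Fin (n + 2)} {θ : ℝ} (hθ : 0 ≤ θ)
    {c : Hist n J → ℝ} (hc : M.Sustainable i c) (T : ℕ) (h : Hist n J) :
    M.partialPayoff c T h +
      M.β / M.δ * (Real.exp (logMult N i θ h) - 1) * Real.log (1 - c h) ≤
    M.partialPayoff (M.multRule N i θ) T h +
      M.β / M.δ * (Real.exp (logMult N i θ h) - 1) * Real.log (1 - M.multRule N i θ h) +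
      M.δ ^ T * (M.β / M.δ * Real.exp (max θ (M.cap W)) * -M.wmin (Fin.last (n + 1))) := by
  induction T generalizing h with
  | zero =>
    have hm := S.logMult_mem i hθ h
    have h1 := (hc.log_one_sub h).2
    have h2 := ((S.multRule_sustainable i hθ).log_one_sub h)
    have hq := div_pos M.β_pos M.δ_pos
    have h3 : 0 ≤ Real.exp (logMult N i θ h) - 1 := by linarith [Real.one_le_exp hm.1]
    have h4 := Real.exp_le_exp.2 hm.2
    have h5 := mul_nonpos_of_nonneg_of_nonpos (mul_nonneg hq.le h3) h1
    -- The terminal promise is not offset by later dates; its bound is what the discount factor `δ ^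
    -- T` removes in the limit.
    have h6 : M.β / M.δ * (Real.exp (logMult N i θ h) - 1) *
        -Real.log (1 - M.multRule N i θ h) ≤
        M.β / M.δ * Real.exp (max θ (M.cap W)) * -M.wmin (Fin.last (n + 1)) := by
      apply mul_le_mul
      · exact mul_le_mul_of_nonneg_left (by linarith) hq.le
      · linarith
      · linarith
      · positivity
    simp only [partialPayoff, Finset.range_zero, Finset.sum_empty, pow_zero]
    linarith
  | succ T ih =>
    have hm := S.logMult_mem i hθ h
    set K := M.β / M.δ * Real.exp (max θ (M.cap W)) * -M.wmin (Fin.last (n + 1))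
    set c' := M.multRule N i θ
    have hstep := S.lagrangian_step hθ hc h rfl rfl
    have hmax : M.β / M.δ * Real.exp (logMult N i θ h) * Real.log (1 - c h) +
        Real.exp (N (curShare i h) (logMult N i θ h)) * Real.log (c h) ≤
        M.β / M.δ * Real.exp (logMult N i θ h) * Real.log (1 - c' h) +
        Real.exp (N (curShare i h) (logMult N i θ h)) * Real.log (c' h) := by
      refine weighted_logs_le (mul_pos (div_pos M.β_pos M.δ_pos) (Real.exp_pos _))
        (Real.exp_pos _) (hc h).1 (hc.lt_one h) (M.young_pos _) (young_lt_one _) ?_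
      have hf : M.β / M.δ * Real.exp (logMult N i θ h) * c' h =
        Real.exp (N (curShare i h) (logMult N i θ h)) * (1 - c' h) := young_foc _ _
      rw [hf, sub_self, mul_zero]
    -- The charge `β (exp m - 1)` on next period's old equals, after discounting by `δ`, the credit
    -- `β / δ (exp m - 1)` in the induction hypothesis: this is the telescoping.
    have hE := M.expNext_mono (φ := fun k => M.partialPayoff c T k +
        M.β / M.δ * (Real.exp (N (curShare i h) (logMult N i θ h)) - 1) * Real.log (1 - c k))
      (φ' := fun k => M.partialPayoff c' T k +
        (M.β / M.δ * (Real.exp (N (curShare i h) (logMult N i θ h)) - 1) * Real.log (1 - c' k) +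
        M.δ ^ T * K)) h fun ρ => by
        have := ih (ρ :: h)
        simp only [logMult] at this
        linarith
    rw [expNext_add, expNext_add, expNext_add, expNext_mul_left, expNext_mul_left, expNext_const] at hE
    have hE' := mul_le_mul_of_nonneg_left hE M.δ_pos.le
    rw [partialPayoff_succ, partialPayoff_succ, pow_succ]
    have e : ∀ a b : ℝ, M.δ * (M.β / M.δ * a * b) = M.β * a * b := fun a b => by
      have := M.δ_pos.ne'
      field_simp
    rw [mul_add, mul_add, mul_add, e, e] at hE'
    linarith

/-- Weak duality: the payoff from a sustainable rule, compared with the rule generated by the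
multipliers, in terms of the initial consumption of the young. -/
theorem payoff_le (S : M.Solution W N) {i : Fin (n + 2)} {θ : ℝ} (hθ : 0 ≤ θ)
    {c : Hist n J → ℝ} (hc : M.Sustainable i c) :
    M.payoff c - (M.β / M.δ * Real.log (1 - c []) + Real.exp (N i θ) * Real.log (c [])) ≤
    M.payoff (M.multRule N i θ) - (M.β / M.δ * Real.log (1 - M.young (N i θ - θ)) +
      Real.exp (N i θ) * Real.log (M.young (N i θ - θ))) := by
  set K := M.β / M.δ * Real.exp (max θ (M.cap W)) * -M.wmin (Fin.last (n + 1)) with hK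
  have hlim : Tendsto (fun T : ℕ => M.partialPayoff (M.multRule N i θ) (T + 1) [] +
      M.δ ^ (T + 1) * K) atTop (𝓝 (M.payoff (M.multRule N i θ) + 0 * K)) :=
    (((S.multRule_sustainable i hθ).tendsto_partialPayoff).comp (tendsto_add_atTop_nat 1)).add
      (((tendsto_pow_atTop_nhds_zero_of_lt_one M.δ_pos.le M.δ_lt_one).comp
        (tendsto_add_atTop_nat 1)).mul_const K)
  have hlim' := hc.tendsto_partialPayoff.comp (tendsto_add_atTop_nat 1)
  rw [zero_mul, add_zero] at hlim
  refine le_of_tendsto_of_tendsto' (hlim'.sub_const _) (hlim.sub_const _) fun T => ?_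
  -- The consumption term of the first date is not maximized out, so that the initial promise can
  -- still be imposed on it.
  have hstep := S.lagrangian_step hθ hc [] rfl rfl
  set c' := M.multRule N i θ with hc'
  have hE := M.expNext_mono (φ := fun k => M.partialPayoff c T k +
      M.β / M.δ * (Real.exp (N i θ) - 1) * Real.log (1 - c k))
    (φ' := fun k => M.partialPayoff c' T k +
      (M.β / M.δ * (Real.exp (N i θ) - 1) * Real.log (1 - c' k) + M.δ ^ T * K)) [] fun ρ => by
      have := S.partialPayoff_le hθ hc T [ρ]
      simp only [logMult, curShare] at this
      linarith
  rw [expNext_add, expNext_add, expNext_add, expNext_mul_left, expNext_mul_left, expNext_const] at hE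
  have hE' := mul_le_mul_of_nonneg_left hE M.δ_pos.le
  have e : ∀ a b : ℝ, M.δ * (M.β / M.δ * a * b) = M.β * a * b := fun a b => by
    have := M.δ_pos.ne'
    field_simp
  rw [mul_add, mul_add, mul_add, e, e] at hE'
  simp only [Function.comp_apply]
  rw [partialPayoff_succ, partialPayoff_succ, pow_succ]
  simp only [logMult, curShare] at hstep
  have e' : M.young (N i θ - θ) = c' [] := rfl
  rw [e']
  linarith

end Solution

end

/-! ### The value function and its supergradients. -/

section

variable {n J : ℕ} {M : Economy n J}

lemma one_sub_exp_pos (h : M.Nonbinding) {i : Fin (n + 2)} {w : ℝ} (hw : w ≤ M.wmax i) :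
    0 < 1 - Real.exp w := by
  have hd := M.dmax_spec h.dmax_pos
  have : M.wmax i < 0 := Real.log_neg (M.promise_arg_pos i h.dmax_pos.le)
    (by nlinarith [M.s_pos i])
  linarith [Real.exp_lt_one_iff.2 (hw.trans_lt this)]

lemma value_le {i : Fin (n + 2)} {w b : ℝ} (h : M.Nonbinding) (hw : w ≤ M.wmax i)
    (hb : ∀ c : Hist n J → ℝ, M.Sustainable i c → w ≤ Real.log (1 - c []) → M.payoff c ≤ b) :
    M.value i w ≤ b := by
  refine csSup_le ⟨_, _, M.sustainable_constant_debt h i, ?_, rfl⟩ ?_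
  · exact hw.trans (M.one_sub_constant_debt i).ge
  · rintro v ⟨c, hc, hcw, rfl⟩
    exact hb c hc hcw

lemma le_value {i : Fin (n + 2)} {w : ℝ} {c : Hist n J → ℝ} (hc : M.Sustainable i c)
    (hw : w ≤ Real.log (1 - c [])) : M.payoff c ≤ M.value i w := by
  refine le_csSup ⟨0, ?_⟩ ⟨c, hc, hw, rfl⟩
  rintro v ⟨c', hc', -, rfl⟩
  exact hc'.payoff_nonpos

namespace Solution

variable {W N : Fin (n + 2) → ℝ → ℝ}

/-- Bound on the value function by means of the multipliers. -/
lemma value_le_aux (h : M.Nonbinding) (S : M.Solution W N) {i : Fin (n + 2)} {θ : ℝ}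
    (hθ : 0 ≤ θ) {w : ℝ} (hw : w ≤ M.wmax i) {x : ℝ}
    (hx : x = min (1 - Real.exp w) (M.young (N i θ))) :
    M.value i w ≤ M.payoff (M.multRule N i θ) +
      (M.β / M.δ * Real.log (1 - x) + Real.exp (N i θ) * Real.log x) -
      (M.β / M.δ * Real.log (1 - M.young (N i θ - θ)) +
        Real.exp (N i θ) * Real.log (M.young (N i θ - θ))) := by
  refine value_le h hw fun c hc hcw => ?_
  -- Without the promise the maximizer of the first-date term is `young (N i θ)`; by concavity the
  -- constrained one is the cut-off `x`.
  have hfoc := young_foc (M := M) 0 (N i θ)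
  rw [Real.exp_zero, mul_one, sub_zero] at hfoc
  have hx0 : 0 < x := hx ▸ lt_min (one_sub_exp_pos h hw) (M.young_pos _)
  have hx1 : x < 1 := hx ▸ (min_le_right _ _).trans_lt (young_lt_one _)
  have hcx : c [] ≤ 1 - Real.exp w := by
    have := (Real.le_log_iff_exp_le (by linarith [hc.lt_one []])).1 hcw
    linarith
  have hq := div_pos M.β_pos M.δ_pos
  have := weighted_logs_le hq (Real.exp_pos (N i θ)) (hc []).1 (hc.lt_one []) hx0 hx1 (by
    rcases le_total (1 - Real.exp w) (M.young (N i θ)) with hle | hle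
    · rw [min_eq_left hle] at hx
      refine mul_nonpos_of_nonneg_of_nonpos (by linarith) ?_
      have h1 : x ≤ M.young (N i θ) := hx.trans_le hle
      have h2 := mul_le_mul_of_nonneg_left h1 hq.le
      have h3 := mul_le_mul_of_nonneg_left h1 (Real.exp_pos (N i θ)).le
      linarith
    · rw [min_eq_right hle] at hx
      rw [hx, hfoc, sub_self, mul_zero])
  linarith [S.payoff_le hθ hc]

lemma exp_W (S : M.Solution W N) (i : Fin (n + 2)) {θ : ℝ} (hθ : 0 ≤ θ) :
    Real.exp (W i θ) = 1 - M.young (N i θ - θ) := by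
  rw [S.W_eq i θ hθ, oldU, Real.exp_log (M.one_sub_young_pos _)]

lemma value_W (h : M.Nonbinding) (S : M.Solution W N) (i : Fin (n + 2)) {θ : ℝ} (hθ : 0 ≤ θ) :
    M.value i (W i θ) = M.payoff (M.multRule N i θ) := by
  refine le_antisymm ?_ (le_value (S.multRule_sustainable i hθ)
    (S.log_one_sub_multRule i hθ []).ge)
  have := S.value_le_aux h hθ (S.W_le h i hθ) (x := M.young (N i θ - θ)) (by
    rw [S.exp_W i hθ, min_eq_left] <;> ring_nf
    exact M.young_strictMono.monotone (by linarith))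
  linarith

/-- The multiplier gives a supergradient of the value function. -/
lemma value_lt_tangent (h : M.Nonbinding) (S : M.Solution W N) {i : Fin (n + 2)} {θ : ℝ}
    (hθ : 0 ≤ θ) {w : ℝ} (hw : w ≤ M.wmax i) (hne : w ≠ W i θ) (hpos : 0 < θ ∨ W i θ < w) :
    M.value i w < M.value i (W i θ) - M.β / M.δ * (Real.exp θ - 1) * (w - W i θ) := by
  set x := min (1 - Real.exp w) (M.young (N i θ)) with hx
  have h1 := S.value_le_aux h hθ hw hx
  rw [S.value_W h i hθ]
  have hx0 : 0 < x := hx ▸ lt_min (one_sub_exp_pos h hw) (M.young_pos _)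
  have hx1 : x < 1 := hx ▸ (min_le_right _ _).trans_lt (young_lt_one _)
  have hq := div_pos M.β_pos M.δ_pos
  have hxne : x ≠ M.young (N i θ - θ) := by
    intro e
    have hW := S.exp_W i hθ
    rcases hpos with hpos | hpos
    · rcases min_choice (1 - Real.exp w) (M.young (N i θ)) with e' | e'
      · exact hne (Real.exp_injective (by rw [hW]; linarith))
      · have := M.young_strictMono.injective (e'.symm.trans (hx.symm.trans e))
        linarith
    · have := Real.exp_lt_exp.2 hpos
      have := min_le_left (1 - Real.exp w) (M.young (N i θ))
      linarith
  -- Raising the weight of the old by the factor `exp θ` makes `young (N i θ - θ)` the strict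
  -- maximizer. The added weight times the promise is the linear term of the tangent.
  have h2 := weighted_logs_lt (mul_pos hq (Real.exp_pos θ)) (Real.exp_pos (N i θ)) hx0 hx1
    (M.young_pos (N i θ - θ)) (young_lt_one _) hxne (by rw [young_foc, sub_self, mul_zero])
  have h3 : w ≤ Real.log (1 - x) := by
    rw [Real.le_log_iff_exp_le (by linarith)]
    have := min_le_left (1 - Real.exp w) (M.young (N i θ))
    linarith
  have h4 : 0 ≤ M.β / M.δ * (Real.exp θ - 1) :=
    mul_nonneg hq.le (by linarith [Real.one_le_exp hθ])
  have h5 := mul_le_mul_of_nonneg_left h3 h4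
  have h6 : W i θ = Real.log (1 - M.young (N i θ - θ)) := S.W_eq i θ hθ
  rw [← h6] at h1 h2
  linarith

lemma value_le_tangent (h : M.Nonbinding) (S : M.Solution W N) {i : Fin (n + 2)} {θ : ℝ}
    (hθ : 0 ≤ θ) {w : ℝ} (hw : w ≤ M.wmax i) :
    M.value i w ≤ M.value i (W i θ) - M.β / M.δ * (Real.exp θ - 1) * (w - W i θ) := by
  rcases eq_or_ne w (W i θ) with rfl | hne
  · simp
  by_cases hpos : 0 < θ ∨ W i θ < w
  · exact (S.value_lt_tangent h hθ hw hne hpos).le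
  · push Not at hpos
    obtain rfl : θ = 0 := le_antisymm hpos.1 hθ
    have h1 := S.value_le_aux h le_rfl hw (x := M.young (N i 0)) (by
      rw [min_eq_right]
      have := Real.exp_le_exp.2 hpos.2
      rw [S.exp_W i le_rfl, sub_zero] at this
      linarith)
    rw [S.value_W h i le_rfl]
    rw [sub_zero] at h1
    simp only [Real.exp_zero, sub_self, mul_zero, zero_mul, sub_zero]
    linarith

/-- At `θ = 0` the supergradient is zero, and the inequality is strict for larger promises. -/
lemma w0_eq (h : M.Nonbinding) (S : M.Solution W N) (i : Fin (n + 2)) : M.w0 i = W i 0 := by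
  refine IsGreatest.csSup_eq ⟨⟨⟨S.wmin_le i 0 le_rfl, S.W_le h i le_rfl⟩, fun w' hw' => ?_⟩, ?_⟩
  · have := S.value_le_tangent h (le_refl (0 : ℝ)) hw'.2
    simpa using this
  · rintro w ⟨hw, hmax⟩
    by_contra hc
    have hlt := not_le.1 hc
    have h1 := S.value_lt_tangent h (le_refl (0 : ℝ)) hw.2 hlt.ne' (Or.inr hlt)
    have h2 := hmax (W i 0) ⟨S.wmin_le i 0 le_rfl, S.W_le h i le_rfl⟩
    simp at h1
    linarith

end Solution

/-! ### Policies and multipliers -/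

/-- The state with share state `r` and previous multiplier `exp θ`. -/
def multState (W : Fin (n + 2) → ℝ → ℝ) (r : Fin (n + 2)) (θ : ℝ) : State n := (r, W r θ)

variable (M) in
/-- The choice generated by the multipliers. -/
def multChoice (W N : Fin (n + 2) → ℝ → ℝ) (r : Fin (n + 2)) (θ : ℝ) :
    ℝ × (Fin (n + 2) → ℝ) := (M.young (N r θ - θ), fun r' => W r' (N r θ))

lemma lagrangian_eq (x : State n) (b : ℝ × (Fin (n + 2) → ℝ)) (μ : ℝ) :
    M.objective b + μ * M.slack x b =
      (M.β / M.δ * Real.log (1 - b.1) + (1 + μ) * Real.log b.1) +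
      M.mean (fun r => M.δ * M.value r (b.2 r) + μ * M.β * b.2 r) - μ * M.autarky x.1 := by
  have : M.mean (fun r => M.δ * M.value r (b.2 r) + μ * M.β * b.2 r) =
      M.δ * ∑ r, M.π r * M.value r (b.2 r) + μ * M.β * ∑ r, M.π r * b.2 r := by
    simp only [mean, Finset.mul_sum, ← Finset.sum_add_distrib]
    exact Finset.sum_congr rfl fun _ _ => by ring
  rw [this]
  unfold objective slack
  ring

namespace Solution

variable {W N : Fin (n + 2) → ℝ → ℝ}

lemma relaxed_multChoice (h : M.Nonbinding) (S : M.Solution W N) (r : Fin (n + 2)) {θ m : ℝ}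
    (hθ : 0 ≤ θ) (hm : 0 ≤ m) :
    M.Relaxed (multState W r θ) (M.young (N r θ - θ), fun r' => W r' m) :=
  ⟨M.young_pos _, (S.W_eq r θ hθ).le, S.young_le r hθ, fun r' =>
    ⟨S.wmin_le r' m hm, S.W_le h r' hm⟩⟩

lemma slack_multChoice (S : M.Solution W N) (r : Fin (n + 2)) {θ : ℝ} (hθ : 0 ≤ θ) :
    0 ≤ M.slack (multState W r θ) (M.multChoice W N r θ) ∧
      (Real.exp (N r θ) - 1) * M.slack (multState W r θ) (M.multChoice W N r θ) = 0 := by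
  have e : M.slack (multState W r θ) (M.multChoice W N r θ) = Real.log (M.young (N r θ - θ)) +
      M.β * M.mean (fun r' => W r' (N r θ)) - M.autarky r := rfl
  rw [e]
  refine ⟨by linarith [S.participation r θ hθ], ?_⟩
  rcases (S.N_nonneg r θ hθ).lt_or_eq with hpos | h0
  · rw [S.binding r θ hθ hpos, sub_self, mul_zero]
  · rw [← h0]; simp

/-- Promise keeping caps consumption at `young (N r θ - θ)`. The weight on the old is here `β / δ`
without the factor `exp θ ≥ 1`, so the objective increases up to the cap. -/
lemma consumption_lt (S : M.Solution W N) {r : Fin (n + 2)} {θ : ℝ} (hθ : 0 ≤ θ)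
    {b : ℝ × (Fin (n + 2) → ℝ)} (hb : M.Relaxed (multState W r θ) b)
    (hne : b.1 ≠ M.young (N r θ - θ)) :
    M.β / M.δ * Real.log (1 - b.1) + Real.exp (N r θ) * Real.log b.1 <
      M.β / M.δ * Real.log (1 - M.young (N r θ - θ)) +
        Real.exp (N r θ) * Real.log (M.young (N r θ - θ)) := by
  obtain ⟨hb0, hb1, hb2, -⟩ := hb
  have hq := div_pos M.β_pos M.δ_pos
  have hlt : b.1 < 1 := hb2.trans_lt (M.s_lt_one _)
  have hle : b.1 ≤ M.young (N r θ - θ) := by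
    have h1 : W r θ ≤ Real.log (1 - b.1) := hb1
    have h2 := (Real.le_log_iff_exp_le (by linarith)).1 h1
    rw [S.exp_W r hθ] at h2
    linarith
  refine weighted_logs_lt hq (Real.exp_pos _) hb0 hlt (M.young_pos _) (young_lt_one _) hne
    (mul_nonpos_of_nonneg_of_nonpos (by linarith) ?_)
  have hfoc := young_foc (M := M) θ (N r θ)
  have := mul_le_mul_of_nonneg_right (mul_le_mul_of_nonneg_left (Real.one_le_exp hθ) hq.le)
    (M.young_pos (N r θ - θ)).le
  linarith

lemma promise_value_le (h : M.Nonbinding) (S : M.Solution W N) {m w : ℝ} (hm : 0 ≤ m)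
    (r : Fin (n + 2)) (hw : w ≤ M.wmax r) :
    M.δ * M.value r w + (Real.exp m - 1) * M.β * w ≤
      M.δ * M.value r (W r m) + (Real.exp m - 1) * M.β * W r m := by
  have h1 := mul_le_mul_of_nonneg_left (S.value_le_tangent h hm hw) M.δ_pos.le
  have := M.δ_pos.ne'
  have e : M.δ * (M.value r (W r m) - M.β / M.δ * (Real.exp m - 1) * (w - W r m)) =
      M.δ * M.value r (W r m) - (Real.exp m - 1) * M.β * (w - W r m) := by
    field_simp
  linarith

/-- The restriction to promises above `w0` matters only at `m = 0`, where smaller promises tie. -/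
lemma promise_value_lt (h : M.Nonbinding) (S : M.Solution W N) {m w : ℝ} (hm : 0 ≤ m)
    (r : Fin (n + 2)) (hw : w ≤ M.wmax r) (hw0 : M.w0 r ≤ w) (hne : w ≠ W r m) :
    M.δ * M.value r w + (Real.exp m - 1) * M.β * w <
      M.δ * M.value r (W r m) + (Real.exp m - 1) * M.β * W r m := by
  have hpos : 0 < m ∨ W r m < w := by
    rcases hm.lt_or_eq with h1 | h1
    · exact Or.inl h1
    · subst h1
      rw [S.w0_eq h] at hw0
      exact Or.inr (lt_of_le_of_ne hw0 hne.symm)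
  have h1 := mul_lt_mul_of_pos_left (S.value_lt_tangent h hm hw hne hpos) M.δ_pos
  have := M.δ_pos.ne'
  have e : M.δ * (M.value r (W r m) - M.β / M.δ * (Real.exp m - 1) * (w - W r m)) =
      M.δ * M.value r (W r m) - (Real.exp m - 1) * M.β * (w - W r m) := by
    field_simp
  linarith

/-- The choice generated by the multipliers maximizes the Lagrangian. -/
lemma lagrangian_le (h : M.Nonbinding) (S : M.Solution W N) {r : Fin (n + 2)} {θ : ℝ}
    (hθ : 0 ≤ θ) {b : ℝ × (Fin (n + 2) → ℝ)} (hb : M.Relaxed (multState W r θ) b) :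
    M.objective b + (Real.exp (N r θ) - 1) * M.slack (multState W r θ) b ≤
      M.objective (M.multChoice W N r θ) +
        (Real.exp (N r θ) - 1) * M.slack (multState W r θ) (M.multChoice W N r θ) := by
  rw [lagrangian_eq, lagrangian_eq, add_sub_cancel]
  have h1 := M.mean_mono fun r' => S.promise_value_le h (S.N_nonneg r θ hθ) r' (hb.2.2.2 r').2
  have h2 : M.β / M.δ * Real.log (1 - b.1) + Real.exp (N r θ) * Real.log b.1 ≤
      M.β / M.δ * Real.log (1 - M.young (N r θ - θ)) +
        Real.exp (N r θ) * Real.log (M.young (N r θ - θ)) := by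
    rcases eq_or_ne b.1 (M.young (N r θ - θ)) with e | hne
    · rw [e]
    · exact (S.consumption_lt hθ hb hne).le
  simp only [multChoice]
  linarith

lemma isOptimalChoice (h : M.Nonbinding) (S : M.Solution W N) (r : Fin (n + 2)) {θ : ℝ}
    (hθ : 0 ≤ θ) : M.IsOptimalChoice (multState W r θ) (M.multChoice W N r θ) := by
  have hN := S.N_nonneg r θ hθ
  have hs := S.slack_multChoice r hθ
  refine ⟨⟨S.relaxed_multChoice h r hθ hN, hs.1⟩, fun b hb => ?_, fun r' => ?_⟩
  · have h1 := S.lagrangian_le h hθ hb.1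
    rw [hs.2] at h1
    have := mul_nonneg (by linarith [Real.one_le_exp hN] : 0 ≤ Real.exp (N r θ) - 1) hb.2
    linarith
  · rw [S.w0_eq h]
    exact S.mono r' 0 _ le_rfl hN

/-- An optimal choice attains the maximum of the Lagrangian; strictness in consumption and in each
promise leaves only the generated choice. -/
lemma policy_eq (h : M.Nonbinding) (S : M.Solution W N) (r : Fin (n + 2)) {θ : ℝ}
    (hθ : 0 ≤ θ) : M.policy (multState W r θ) = M.multChoice W N r θ := by
  have hN := S.N_nonneg r θ hθ
  have hopt := S.isOptimalChoice h r hθ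
  have hb : M.IsOptimalChoice (multState W r θ) (M.policy (multState W r θ)) :=
    Classical.epsilon_spec ⟨_, hopt⟩
  set b := M.policy (multState W r θ)
  have h1 := hb.2.1 _ hopt.1
  have h2 := mul_nonneg (by linarith [Real.one_le_exp hN] : 0 ≤ Real.exp (N r θ) - 1) hb.1.2
  have hle : M.objective (M.multChoice W N r θ) +
      (Real.exp (N r θ) - 1) * M.slack (multState W r θ) (M.multChoice W N r θ) ≤
      M.objective b + (Real.exp (N r θ) - 1) * M.slack (multState W r θ) b := by
    rw [(S.slack_multChoice r hθ).2]; linarith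
  rw [lagrangian_eq, lagrangian_eq, add_sub_cancel] at hle
  simp only [multChoice] at hle
  have hmean : ∀ r', M.δ * M.value r' (b.2 r') + (Real.exp (N r θ) - 1) * M.β * b.2 r' ≤
      M.δ * M.value r' (W r' (N r θ)) + (Real.exp (N r θ) - 1) * M.β * W r' (N r θ) :=
    fun r' => S.promise_value_le h hN r' (hb.1.1.2.2.2 r').2
  have e1 : b.1 = M.young (N r θ - θ) := by
    by_contra hne
    have := S.consumption_lt hθ hb.1.1 hne
    have := M.mean_mono hmean
    linarith
  refine Prod.ext e1 (funext fun r' => ?_)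
  by_contra hne
  have := M.mean_lt hmean r'
    (S.promise_value_lt h hN r' (hb.1.1.2.2.2 r').2 (hb.2.2 r') hne)
  rw [e1] at hle
  linarith

lemma f_eq (h : M.Nonbinding) (S : M.Solution W N) (r : Fin (n + 2)) {θ : ℝ} (hθ : 0 ≤ θ) :
    M.f (multState W r θ) = M.young (N r θ - θ) := by rw [f, S.policy_eq h r hθ]; rfl

lemma next_eq (h : M.Nonbinding) (S : M.Solution W N) (r r' : Fin (n + 2)) {θ : ℝ}
    (hθ : 0 ≤ θ) : M.next (multState W r θ) r' = multState W r' (N r θ) := by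
  rw [next, S.policy_eq h r hθ]; rfl

lemma isMultiplier (h : M.Nonbinding) (S : M.Solution W N) (r : Fin (n + 2)) {θ : ℝ}
    (hθ : 0 ≤ θ) : M.IsMultiplier (multState W r θ) (Real.exp (N r θ) - 1) := by
  have := Real.one_le_exp (S.N_nonneg r θ hθ)
  rw [IsMultiplier, S.policy_eq h r hθ]
  exact ⟨by linarith, (S.slack_multChoice r hθ).2, fun b hb => S.lagrangian_le h hθ hb⟩

/-- The multiplier is unique. -/
lemma IsMultiplier.eq (h : M.Nonbinding) (S : M.Solution W N) {r : Fin (n + 2)} {θ μ : ℝ}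
    (hθ : 0 ≤ θ) (hμ : M.IsMultiplier (multState W r θ) μ) : μ = Real.exp (N r θ) - 1 := by
  have hN := S.N_nonneg r θ hθ
  obtain ⟨hμ0, -, hmax⟩ := hμ
  rw [S.policy_eq h r hθ] at hmax
  obtain ⟨m, hm0, hm⟩ : ∃ m, 0 ≤ m ∧ μ = Real.exp m - 1 :=
    ⟨Real.log (1 + μ), Real.log_nonneg (by linarith), by
      rw [Real.exp_log (by linarith)]; ring⟩
  -- Test the Lagrangian with the promises `W r' q` and add the supergradient inequality at `q`.
  -- Below, a `q` halfway between `m` and `N r θ` gives the wrong sign, since `W` is strictly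
  -- increasing.
  have key : ∀ q, 0 ≤ q → (Real.exp m - Real.exp q) *
      (M.mean (fun r' => W r' q) - M.mean (fun r' => W r' (N r θ))) ≤ 0 := by
    intro q hq
    have h1 := hmax _ (S.relaxed_multChoice h r hθ hq)
    rw [lagrangian_eq, lagrangian_eq] at h1
    simp only [multChoice] at h1
    have h2 := M.mean_mono fun r' => S.promise_value_le h hq r' (S.W_le h r' hN)
    have hadd : ∀ (a : ℝ) (φ ψ : Fin (n + 2) → ℝ),
        M.mean (fun r' => φ r' + a * ψ r') = M.mean φ + a * M.mean ψ := fun a φ ψ => by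
      rw [← mean_mul_left]
      simp only [mean, mul_add, Finset.sum_add_distrib]
    rw [hadd, hadd] at h1 h2
    rw [hm] at h1
    have hβ := M.β_pos
    by_contra hc
    have := mul_pos hβ (not_le.1 hc)
    nlinarith
  have hstrict : ∀ {q q' : ℝ}, 0 ≤ q → q < q' →
      M.mean (fun r' => W r' q) < M.mean (fun r' => W r' q') := fun hq hqq =>
    M.mean_lt (fun r' => S.mono r' _ _ hq hqq.le) 0 (S.W_strictMono h 0 hq hqq)
  rcases lt_trichotomy m (N r θ) with hlt | heq | hgt
  · have h1 := key ((m + N r θ) / 2) (by linarith)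
    have h2 := hstrict (q := (m + N r θ) / 2) (q' := N r θ) (by linarith) (by linarith)
    have h3 := Real.exp_lt_exp.2 (by linarith : m < (m + N r θ) / 2)
    nlinarith
  · rw [hm, heq]
  · have h1 := key ((m + N r θ) / 2) (by linarith)
    have h2 := hstrict (q := N r θ) (q' := (m + N r θ) / 2) hN (by linarith)
    have h3 := Real.exp_lt_exp.2 (by linarith : (m + N r θ) / 2 < m)
    nlinarith

lemma nu_eq (h : M.Nonbinding) (S : M.Solution W N) (r : Fin (n + 2)) {θ : ℝ} (hθ : 0 ≤ θ) :
    M.nu (multState W r θ) = Real.exp (N r θ) := by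
  have : M.IsMultiplier (multState W r θ) (M.mu (multState W r θ)) :=
    Classical.epsilon_spec ⟨_, S.isMultiplier h r hθ⟩
  rw [nu, IsMultiplier.eq h S hθ this]
  ring

/-! ### The ergodic set -/

lemma start_eq (h : M.Nonbinding) (S : M.Solution W N) :
    ((0, M.w0 0) : State n) = multState W 0 0 := by rw [S.w0_eq h]; rfl

lemma ergodicSet_next {x : State n} (hx : x ∈ M.ergodicSet) (r : Fin (n + 2)) :
    M.next x r ∈ M.ergodicSet := Relation.TransGen.tail hx ⟨r, rfl⟩

lemma exists_of_mem_ergodicSet (h : M.Nonbinding) (S : M.Solution W N) {x : State n}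
    (hx : x ∈ M.ergodicSet) : ∃ r θ, 0 ≤ θ ∧ θ ≤ M.cap W ∧ x = multState W r θ := by
  have hx' : Relation.TransGen (fun y z => ∃ r, z = M.next y r) (0, M.w0 0) x := hx
  induction hx' with
  | single hy =>
    obtain ⟨r, rfl⟩ := hy
    rw [S.start_eq h, S.next_eq h _ _ le_rfl]
    exact ⟨r, N 0 0, S.N_nonneg _ _ le_rfl, S.N_le_cap _ S.cap_mem.1, rfl⟩
  | tail hy hz ih =>
    obtain ⟨r, rfl⟩ := hz
    obtain ⟨q, θ, h0, h1, rfl⟩ := ih hy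
    rw [S.next_eq h _ _ h0]
    exact ⟨r, N q θ, S.N_nonneg _ _ h0, S.N_le_cap _ h1, rfl⟩

lemma start_next_mem (h : M.Nonbinding) (S : M.Solution W N) (r : Fin (n + 2)) :
    multState W r 0 ∈ M.ergodicSet := by
  have : M.next (0, M.w0 0) r = multState W r 0 := by
    rw [S.start_eq h, S.next_eq h _ _ le_rfl, S.zero_zero h]
  exact this ▸ Relation.TransGen.single ⟨r, rfl⟩

lemma iterate_last_mem_ergodicSet (h : M.Nonbinding) (S : M.Solution W N) (k : ℕ) :
    multState W (Fin.last (n + 1)) ((N (Fin.last (n + 1)))^[k] 0) ∈ M.ergodicSet := by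
  induction k with
  | zero => exact S.start_next_mem h _
  | succ k ih =>
    rw [Function.iterate_succ_apply', ← S.next_eq h _ _ (S.iterate_last_mem k).1]
    exact ergodicSet_next ih _

lemma multState_continuousOn (S : M.Solution W N) (r : Fin (n + 2)) :
    ContinuousOn (multState W r) (Set.Ici 0) :=
  continuousOn_const.prodMk (S.toAdmissible.continuousOn r)

lemma exists_of_mem_closure (h : M.Nonbinding) (S : M.Solution W N) {x : State n}
    (hx : x ∈ closure M.ergodicSet) : ∃ r θ, 0 ≤ θ ∧ θ ≤ M.cap W ∧ x = multState W r θ := by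
  have hcl : IsClosed (⋃ r, multState W r '' Set.Icc 0 (M.cap W)) :=
    isClosed_iUnion_of_finite fun r => (isCompact_Icc.image_of_continuousOn
      ((S.multState_continuousOn r).mono Set.Icc_subset_Ici_self)).isClosed
  have hsub : M.ergodicSet ⊆ ⋃ r, multState W r '' Set.Icc 0 (M.cap W) := fun y hy => by
    obtain ⟨r, θ, h0, h1, rfl⟩ := S.exists_of_mem_ergodicSet h hy
    exact Set.mem_iUnion.2 ⟨r, θ, ⟨h0, h1⟩, rfl⟩
  obtain ⟨r, θ, ⟨h0, h1⟩, rfl⟩ := Set.mem_iUnion.1 (closure_minimal hsub hcl hx)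
  exact ⟨r, θ, h0, h1, rfl⟩

lemma last_mem_closure (h : M.Nonbinding) (S : M.Solution W N) :
    multState W (Fin.last (n + 1)) (M.cap W) ∈ closure M.ergodicSet := by
  refine mem_closure_of_tendsto (b := atTop)
    (f := fun k => multState W (Fin.last (n + 1)) ((N (Fin.last (n + 1)))^[k] 0)) ?_
    (Eventually.of_forall fun k => S.iterate_last_mem_ergodicSet h k)
  exact (S.multState_continuousOn _ _ S.cap_mem.1).tendsto.comp (tendsto_nhdsWithin_iff.2
    ⟨S.tendsto_iterate_last, Eventually.of_forall fun k => (S.iterate_last_mem k).1⟩)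

end Solution

end

section

variable {n J : ℕ} {M : Economy n J}

/-! ### Growth -/

lemma gbar_pos : 0 < M.gbar := by
  refine inv_pos.2 (Finset.sum_pos (fun j _ => mul_pos (M.ς_pos j) (inv_pos.2 (M.γ_pos j))) ?_)
  by_contra hc
  have := M.ς_sum
  rw [Finset.not_nonempty_iff_eq_empty.1 hc] at this
  simp at this

/-- The marginal rate of substitution depends on levels only through the growth factor, which is
independent of shares; each period contributes the expectation of `γ⁻¹`. -/
lemma pricePlus_eq (k : ℕ) (x : State n) {e : ℝ} (he : 0 < e) :
    M.pricePlus k (x, e) = (M.gbar⁻¹) ^ k * M.price k x := by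
  induction k generalizing x e with
  | zero => simp [pricePlus, price]
  | succ k ih =>
    have h1 : M.pricePlus (k + 1) (x, e) = M.Qplus (M.pricePlus k) (x, e) := by
      rw [pricePlus, Function.iterate_succ_apply']; rfl
    have h2 : M.price (k + 1) x = M.Q (M.price k) x := by
      rw [price, Function.iterate_succ_apply']; rfl
    rw [h1, h2, Qplus, Q, Finset.mul_sum]
    refine Finset.sum_congr rfl fun r _ => ?_
    have hg : M.gbar⁻¹ = ∑ j, M.ς j * (M.γ j)⁻¹ := inv_inv _
    rw [pow_succ', mul_assoc, hg, Finset.sum_mul, ← hg]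
    refine Finset.sum_congr rfl fun j _ => ?_
    rw [ih _ (mul_pos (M.γ_pos j) he)]
    have hm : M.mrs (M.f x * e) ((1 - M.f (M.next x r)) * (M.γ j * e)) =
        M.mrs (M.f x) (1 - M.f (M.next x r)) * (M.γ j)⁻¹ := by
      have := he.ne'
      have := (M.γ_pos j).ne'
      simp only [mrs, mul_inv, div_eq_mul_inv, inv_inv]
      field_simp
    rw [hm]
    ring

lemma yieldPlus_eq {x : State n} {e : ℝ} (he : 0 < e) {k : ℕ} (hk : 1 ≤ k)
    (hx : 0 < M.price k x) : M.yieldPlus k (x, e) = M.yield k x + Real.log M.gbar := by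
  have hg := inv_pos.2 (gbar_pos (M := M))
  have hk' : (k : ℝ) ≠ 0 := by positivity
  rw [yieldPlus, yield, pricePlus_eq k x he, Real.log_mul (pow_pos hg k).ne' hx.ne', Real.log_pow,
    Real.log_inv]
  field_simp
  ring

/-! ### The eigenvector of the state prices. -/

variable (M) in
/-- Eigenvector of the state prices: consumption of the young over the multiplier. -/
def kernel (N : Fin (n + 2) → ℝ → ℝ) (r : Fin (n + 2)) (θ : ℝ) : ℝ :=
  M.δ / (M.β * Real.exp θ + M.δ * Real.exp (N r θ))

lemma kernel_den_pos (N : Fin (n + 2) → ℝ → ℝ) (r : Fin (n + 2)) (θ : ℝ) :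
    0 < M.β * Real.exp θ + M.δ * Real.exp (N r θ) := by
  have := M.β_pos; have := M.δ_pos; positivity

lemma kernel_pos (N : Fin (n + 2) → ℝ → ℝ) (r : Fin (n + 2)) (θ : ℝ) : 0 < M.kernel N r θ :=
  div_pos M.δ_pos (kernel_den_pos N r θ)

lemma young_eq_kernel (N : Fin (n + 2) → ℝ → ℝ) (r : Fin (n + 2)) (θ : ℝ) :
    M.young (N r θ - θ) = M.kernel N r θ * Real.exp (N r θ) := by
  have h1 := (kernel_den_pos (M := M) N r θ).ne'
  have h2 := (M.den_pos (N r θ - θ)).ne'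
  have e : Real.exp (N r θ) = Real.exp θ * Real.exp (N r θ - θ) := by
    rw [← Real.exp_add]; ring_nf
  rw [young, kernel]
  rw [e] at h1 ⊢
  field_simp

lemma one_sub_young_eq_kernel (N : Fin (n + 2) → ℝ → ℝ) (r : Fin (n + 2)) (θ : ℝ) :
    1 - M.young (N r θ - θ) = M.β / M.δ * Real.exp θ * M.kernel N r θ := by
  have h1 := (kernel_den_pos (M := M) N r θ).ne'
  have h2 := M.δ_pos.ne'
  rw [young_eq_kernel, kernel]
  field_simp
  ring

lemma price_succ (k : ℕ) (x : State n) : M.price (k + 1) x = M.Q (M.price k) x := by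
  rw [price, Function.iterate_succ_apply']; rfl

lemma abs_mean_le {v : Fin (n + 2) → ℝ} {b B : ℝ} (h0 : |v 0| ≤ b) (h : ∀ r, |v r| ≤ B) :
    |M.mean v| ≤ M.π 0 * b + (1 - M.π 0) * B := by
  have h1 : |M.mean v| ≤ M.mean (fun r => |v r|) := by
    refine (Finset.abs_sum_le_sum_abs _ _).trans (Finset.sum_le_sum fun r _ => ?_)
    rw [abs_mul, abs_of_pos (M.π_pos r)]
  have h2 : M.π 0 * (B - |v 0|) ≤ M.mean (fun r => B - |v r|) :=
    Finset.single_le_sum (f := fun r => M.π r * (B - |v r|))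
      (fun r _ => mul_nonneg (M.π_pos r).le (sub_nonneg.2 (h r))) (Finset.mem_univ 0)
  rw [mean_sub, mean_const] at h2
  have h3 := mul_le_mul_of_nonneg_left h0 (M.π_pos 0).le
  linarith

namespace Solution

variable {W N : Fin (n + 2) → ℝ → ℝ}

/-! ### State prices and bond prices -/

lemma Q_eq (h : M.Nonbinding) (S : M.Solution W N) (φ : State n → ℝ) (r : Fin (n + 2)) {θ : ℝ}
    (hθ : 0 ≤ θ) : M.Q φ (multState W r θ) = M.β * M.young (N r θ - θ) *
      M.mean (fun r' => Real.exp (-W r' (N r θ)) * φ (multState W r' (N r θ))) := by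
  have hN := S.N_nonneg r θ hθ
  unfold Q mean
  rw [Finset.mul_sum]
  refine Finset.sum_congr rfl fun r' _ => ?_
  simp only [S.next_eq h _ _ hθ, S.f_eq h _ hθ, S.f_eq h _ hN, Real.exp_neg, S.exp_W _ hN, mrs,
    div_inv_eq_mul]
  ring

lemma Q_eq_kernel (h : M.Nonbinding) (S : M.Solution W N) (φ : State n → ℝ) (r : Fin (n + 2))
    {θ : ℝ} (hθ : 0 ≤ θ) : M.Q φ (multState W r θ) = M.δ * M.kernel N r θ *
      M.mean (fun r' => φ (multState W r' (N r θ)) / M.kernel N r' (N r θ)) := by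
  have hN := S.N_nonneg r θ hθ
  rw [S.Q_eq h φ r hθ, ← mean_mul_left, ← mean_mul_left]
  congr 1
  funext r'
  rw [Real.exp_neg, S.exp_W _ hN, one_sub_young_eq_kernel, young_eq_kernel]
  have := M.β_pos.ne'
  have := M.δ_pos.ne'
  have := (kernel_pos (M := M) N r' (N r θ)).ne'
  have := (Real.exp_pos (N r θ)).ne'
  field_simp

lemma kernel_le (S : M.Solution W N) (r : Fin (n + 2)) {θ : ℝ} (hθ : 0 ≤ θ) :
    M.kernel N r θ ≤ M.δ / (M.β + M.δ) := by
  have hβ := M.β_pos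
  have hδ := M.δ_pos
  refine div_le_div_of_nonneg_left hδ.le (by positivity) ?_
  nlinarith [Real.one_le_exp hθ, Real.one_le_exp (S.N_nonneg r θ hθ)]

lemma le_kernel (S : M.Solution W N) (r : Fin (n + 2)) {θ : ℝ} (hθ' : θ ≤ M.cap W) :
    M.δ / ((M.β + M.δ) * Real.exp (M.cap W)) ≤ M.kernel N r θ := by
  have hβ := M.β_pos
  have hδ := M.δ_pos
  refine div_le_div_of_nonneg_left hδ.le (kernel_den_pos N r θ) ?_
  nlinarith [Real.exp_le_exp.2 hθ', Real.exp_le_exp.2 (S.N_le_cap r hθ')]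

lemma price_pos (h : M.Nonbinding) (S : M.Solution W N) (k : ℕ) (r : Fin (n + 2)) {θ : ℝ}
    (hθ : 0 ≤ θ) : 0 < M.price k (multState W r θ) := by
  induction k generalizing r θ with
  | zero => simp [price]
  | succ k ih =>
    rw [price_succ, S.Q_eq h _ r hθ]
    refine mul_pos (mul_pos M.β_pos (M.young_pos _)) (Finset.sum_pos (fun r' _ => ?_)
      ⟨0, Finset.mem_univ _⟩)
    exact mul_pos (M.π_pos r') (mul_pos (Real.exp_pos _) (ih r' (S.N_nonneg r θ hθ)))

/-- Bond prices fall with the multiplier. -/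
lemma price_antitone (h : M.Nonbinding) (S : M.Solution W N) (k : ℕ) (r : Fin (n + 2))
    {θ θ' : ℝ} (hθ : 0 ≤ θ) (hle : θ ≤ θ') :
    M.price k (multState W r θ') ≤ M.price k (multState W r θ) := by
  induction k generalizing r θ θ' with
  | zero => simp [price]
  | succ k ih =>
    have hθ' := hθ.trans hle
    have hN := S.N_nonneg r θ hθ
    have hNN := S.N_mono r θ θ' hθ hle
    rw [price_succ, price_succ, S.Q_eq h _ r hθ, S.Q_eq h _ r hθ']
    -- As `θ` rises, all three factors fall: current consumption because `N - θ` falls, the marginal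
    -- utility of the old because promises rise, and the continuation price by induction.
    refine mul_le_mul (mul_le_mul_of_nonneg_left (M.young_strictMono.monotone ?_) M.β_pos.le)
      (M.mean_mono fun r' => mul_le_mul (Real.exp_le_exp.2 ?_) (ih r' hN hNN)
        (S.price_pos h k r' (hN.trans hNN)).le (Real.exp_pos _).le) ?_
      (mul_pos M.β_pos (M.young_pos _)).le
    · linarith [S.N_lip r θ θ' hθ hle]
    · exact neg_le_neg (S.mono r' _ _ hN hNN)
    · exact Finset.sum_nonneg fun r' _ => mul_nonneg (M.π_pos r').le
        (mul_pos (Real.exp_pos _) (S.price_pos h k r' (hN.trans hNN))).le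

/-- The kernel, scaled by two constants, sandwiches the payoff 1 from both sides, and `Q` multiplies
it by `δ` at each step. -/
lemma price_bounds (h : M.Nonbinding) (S : M.Solution W N) (k : ℕ) (r : Fin (n + 2)) {θ : ℝ}
    (hθ : 0 ≤ θ) (hθ' : θ ≤ M.cap W) :
    M.δ ^ k * (M.kernel N r θ * ((M.β + M.δ) / M.δ)) ≤ M.price k (multState W r θ) ∧
    M.price k (multState W r θ) ≤
      M.δ ^ k * (M.kernel N r θ * ((M.β + M.δ) * Real.exp (M.cap W) / M.δ)) := by
  have hβ := M.β_pos
  have hδ := M.δ_pos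
  induction k generalizing r θ with
  | zero =>
    have h1 := S.kernel_le r hθ
    have h2 := S.le_kernel r hθ'
    rw [le_div_iff₀ (by positivity)] at h1
    rw [div_le_iff₀ (by positivity)] at h2
    simp only [price, Function.iterate_zero, id_eq, pow_zero, one_mul]
    rw [← mul_div_assoc, ← mul_div_assoc, div_le_one hδ, one_le_div hδ]
    exact ⟨h1, h2⟩
  | succ k ih =>
    rw [price_succ, S.Q_eq_kernel h _ r hθ, pow_succ]
    have hN := S.N_nonneg r θ hθ
    have hN' := S.N_le_cap r hθ'
    have hk := kernel_pos (M := M) N r θ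
    have h1 := M.mean_mono (φ := fun _ => M.δ ^ k * ((M.β + M.δ) / M.δ))
      (φ' := fun r' => M.price k (multState W r' (N r θ)) / M.kernel N r' (N r θ)) fun r' => by
        rw [le_div_iff₀ (kernel_pos N r' _)]
        linarith [(ih r' hN hN').1]
    have h2 := M.mean_mono (φ' := fun _ => M.δ ^ k * ((M.β + M.δ) * Real.exp (M.cap W) / M.δ))
      (φ := fun r' => M.price k (multState W r' (N r θ)) / M.kernel N r' (N r θ)) fun r' => by
        rw [div_le_iff₀ (kernel_pos N r' _)]
        linarith [(ih r' hN hN').2]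
    rw [mean_const] at h1 h2
    have h3 := mul_le_mul_of_nonneg_left h1 (mul_pos hδ hk).le
    have h4 := mul_le_mul_of_nonneg_left h2 (mul_pos hδ hk).le
    constructor <;> linarith

lemma tendsto_yield (h : M.Nonbinding) (S : M.Solution W N) (r : Fin (n + 2)) {θ : ℝ}
    (hθ : 0 ≤ θ) (hθ' : θ ≤ M.cap W) :
    Tendsto (fun k => M.yield k (multState W r θ)) atTop (𝓝 (-Real.log M.δ)) := by
  have hβ := M.β_pos
  have hδ := M.δ_pos
  have hk := kernel_pos (M := M) N r θ
  set a := M.kernel N r θ * ((M.β + M.δ) / M.δ) with ha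
  set b := M.kernel N r θ * ((M.β + M.δ) * Real.exp (M.cap W) / M.δ) with hb
  have ha0 : 0 < a := by positivity
  have hb0 : 0 < b := by positivity
  rw [tendsto_iff_norm_sub_tendsto_zero]
  refine squeeze_zero' (Eventually.of_forall fun k => norm_nonneg _) ?_
    (tendsto_const_div_atTop_nhds_zero_nat (|Real.log a| + |Real.log b|))
  filter_upwards [eventually_ge_atTop 1] with k hk1
  have hk0 : (0 : ℝ) < k := by exact_mod_cast hk1
  have hp := S.price_bounds h k r hθ hθ'
  have hp0 := S.price_pos h k r hθ
  have h1 := Real.log_le_log (by positivity) hp.1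
  have h2 := Real.log_le_log hp0 hp.2
  rw [Real.log_mul (by positivity) (by positivity), Real.log_pow] at h1 h2
  have e : M.yield k (multState W r θ) - -Real.log M.δ =
      -(Real.log (M.price k (multState W r θ)) - k * Real.log M.δ) / k := by
    unfold yield; field_simp; ring
  rw [e, Real.norm_eq_abs, abs_div, abs_of_pos hk0, abs_neg]
  refine div_le_div_of_nonneg_right (abs_le.2 ⟨?_, ?_⟩) hk0.le
  · linarith [neg_abs_le (Real.log a), abs_nonneg (Real.log b)]
  · linarith [le_abs_self (Real.log b), abs_nonneg (Real.log a)]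

lemma price_one (h : M.Nonbinding) (S : M.Solution W N) (r : Fin (n + 2)) {θ : ℝ}
    (hθ : 0 ≤ θ) : M.price 1 (multState W r θ) = M.kernel N r θ *
      M.mean (fun r' => M.β * Real.exp (N r θ) + M.δ * Real.exp (N r' (N r θ))) := by
  have hδ := M.δ_pos.ne'
  have e : M.price 1 (multState W r θ) = M.Q (fun _ => 1) (multState W r θ) := rfl
  rw [e, S.Q_eq_kernel h _ r hθ, ← mean_mul_left, ← mean_mul_left]
  congr 1
  funext r'
  have := (kernel_den_pos (M := M) N r' (N r θ)).ne'
  unfold kernel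
  field_simp

lemma kernel_start (h : M.Nonbinding) (S : M.Solution W N) :
    M.kernel N 0 0 = M.δ / (M.β + M.δ) := by
  rw [kernel, S.zero_zero h, Real.exp_zero, mul_one, mul_one]

lemma kernel_last (S : M.Solution W N) : M.kernel N (Fin.last (n + 1)) (M.cap W) =
    M.δ / ((M.β + M.δ) * Real.exp (M.cap W)) := by
  rw [kernel, S.N_last_cap]; congr 1; ring

/-- From multiplier one, later multipliers can only be larger, strictly so after the highest share.
-/
lemma lt_price_one_start (h : M.Nonbinding) (S : M.Solution W N) :
    M.δ < M.price 1 (multState W 0 0) := by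
  have hβ := M.β_pos
  have hδ := M.δ_pos
  rw [S.price_one h 0 le_rfl, S.zero_zero h, S.kernel_start h]
  have h1 := M.mean_lt (φ := fun _ => M.β + M.δ)
    (φ' := fun r' => M.β * Real.exp 0 + M.δ * Real.exp (N r' 0))
    (fun r => by
      rw [Real.exp_zero]
      nlinarith [Real.one_le_exp (S.N_nonneg r 0 le_rfl)]) (Fin.last (n + 1)) (by
      rw [Real.exp_zero]
      nlinarith [Real.one_lt_exp_iff.2 (S.last_zero_pos h)])
  rw [mean_const] at h1
  rw [div_mul_eq_mul_div, lt_div_iff₀ (by positivity)]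
  exact mul_lt_mul_of_pos_left h1 hδ

/-- From `cap`, later multipliers can only be smaller, strictly so after the lowest share. -/
lemma price_one_last_lt (h : M.Nonbinding) (S : M.Solution W N) :
    M.price 1 (multState W (Fin.last (n + 1)) (M.cap W)) < M.δ := by
  have hβ := M.β_pos
  have hδ := M.δ_pos
  rw [S.price_one h _ S.cap_mem.1, S.N_last_cap, S.kernel_last]
  have h1 := M.mean_lt (φ' := fun _ => (M.β + M.δ) * Real.exp (M.cap W))
    (φ := fun r' => M.β * Real.exp (M.cap W) + M.δ * Real.exp (N r' (M.cap W)))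
    (fun r => by
      have := mul_le_mul_of_nonneg_left (Real.exp_le_exp.2 (S.N_le_cap r le_rfl)) hδ.le
      linarith) 0 (by
      have := mul_lt_mul_of_pos_left (Real.exp_lt_exp.2 (S.zero_lt h (S.cap_pos h))) hδ
      linarith)
  rw [mean_const] at h1
  rw [div_mul_eq_mul_div, div_lt_iff₀ (by positivity)]
  exact mul_lt_mul_of_pos_left h1 hδ

/-! ### Perron pairs -/

lemma f_div_nu (h : M.Nonbinding) (S : M.Solution W N) (r : Fin (n + 2)) {θ : ℝ} (hθ : 0 ≤ θ) :
    M.f (multState W r θ) / M.nu (multState W r θ) = M.kernel N r θ := by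
  rw [S.f_eq h r hθ, S.nu_eq h r hθ, young_eq_kernel, mul_div_cancel_right₀ _ (Real.exp_pos _).ne']

lemma f_div_nu_bounds (h : M.Nonbinding) (S : M.Solution W N) {x : State n}
    (hx : x ∈ M.ergodicSet) : M.δ / ((M.β + M.δ) * Real.exp (M.cap W)) ≤ M.f x / M.nu x ∧
      M.f x / M.nu x ≤ M.δ / (M.β + M.δ) := by
  obtain ⟨r, θ, h0, h1, rfl⟩ := S.exists_of_mem_ergodicSet h hx
  rw [S.f_div_nu h r h0]
  exact ⟨S.le_kernel r h1, S.kernel_le r h0⟩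

/-- In units of the eigenvector `f / ν`, state prices are discounted probabilities. -/
lemma Q_eq_mean (h : M.Nonbinding) (S : M.Solution W N) (φ : State n → ℝ) {x : State n}
    (hx : x ∈ M.ergodicSet) : M.Q φ x / (M.f x / M.nu x) =
      M.δ * M.mean (fun r => φ (M.next x r) / (M.f (M.next x r) / M.nu (M.next x r))) := by
  obtain ⟨r, θ, h0, h1, rfl⟩ := S.exists_of_mem_ergodicSet h hx
  have hk := (kernel_pos (M := M) N r θ).ne'
  rw [S.Q_eq_kernel h φ r h0, S.f_div_nu h r h0]
  simp only [S.next_eq h r _ h0, S.f_div_nu h _ (S.N_nonneg r θ h0)]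
  field_simp

lemma kernel_lower_pos (W : Fin (n + 2) → ℝ → ℝ) :
    0 < M.δ / ((M.β + M.δ) * Real.exp (M.cap W)) := by
  have := M.β_pos; have := M.δ_pos; positivity

lemma isPerronPair (h : M.Nonbinding) (S : M.Solution W N) :
    M.IsPerronPair M.δ (fun x => M.f x / M.nu x) := by
  refine ⟨⟨_, _, kernel_lower_pos W, fun x hx => S.f_div_nu_bounds h hx⟩, fun x hx => ?_⟩
  have hpos : ∀ {y}, y ∈ M.ergodicSet → 0 < M.f y / M.nu y := fun hy =>
    (kernel_lower_pos W).trans_le (S.f_div_nu_bounds h hy).1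
  rw [← div_eq_iff (hpos hx).ne', S.Q_eq_mean h _ hx]
  have : (fun r => M.f (M.next x r) / M.nu (M.next x r) /
      (M.f (M.next x r) / M.nu (M.next x r))) = fun _ => 1 :=
    funext fun r => div_self (hpos (ergodicSet_next hx r)).ne'
  rw [this, mean_const, mul_one]

/-- A bounded positive function on the ergodic set that is multiplied by `ϱ / δ` when expectations
are taken is constant, and `ϱ = δ`. -/
lemma root_eq_of_mean {u : State n → ℝ} {ϱ a b : ℝ} (hne : M.ergodicSet.Nonempty) (ha : 0 < a)
    (hu : ∀ x ∈ M.ergodicSet, a ≤ u x ∧ u x ≤ b)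
    (he : ∀ x ∈ M.ergodicSet, ϱ * u x = M.δ * M.mean (fun r => u (M.next x r))) : ϱ = M.δ := by
  have hδ := M.δ_pos
  have hne' := hne.image u
  have hbdd : BddAbove (u '' M.ergodicSet) := ⟨b, by rintro _ ⟨x, hx, rfl⟩; exact (hu x hx).2⟩
  have hbdd' : BddBelow (u '' M.ergodicSet) := ⟨a, by rintro _ ⟨x, hx, rfl⟩; exact (hu x hx).1⟩
  have hlow : a ≤ sInf (u '' M.ergodicSet) := le_csInf hne' (by
    rintro _ ⟨x, hx, rfl⟩; exact (hu x hx).1)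
  have hup : ∀ x ∈ M.ergodicSet, ϱ * u x ≤ M.δ * sSup (u '' M.ergodicSet) := fun x hx => by
    rw [he x hx]
    have := M.mean_mono (φ' := fun _ => sSup (u '' M.ergodicSet)) fun r =>
      le_csSup hbdd ⟨_, ergodicSet_next hx r, rfl⟩
    rw [mean_const] at this
    exact mul_le_mul_of_nonneg_left this hδ.le
  have hdn : ∀ x ∈ M.ergodicSet, M.δ * sInf (u '' M.ergodicSet) ≤ ϱ * u x := fun x hx => by
    rw [he x hx]
    have := M.mean_mono (φ := fun _ => sInf (u '' M.ergodicSet)) fun r =>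
      csInf_le hbdd' ⟨_, ergodicSet_next hx r, rfl⟩
    rw [mean_const] at this
    exact mul_le_mul_of_nonneg_left this hδ.le
  obtain ⟨x₀, hx₀⟩ := hne
  have hϱ : 0 < ϱ := by
    have h1 := (mul_pos hδ (ha.trans_le hlow)).trans_le (hdn x₀ hx₀)
    exact pos_of_mul_pos_left h1 (ha.trans_le (hu x₀ hx₀).1).le
  have hs0 : 0 < sSup (u '' M.ergodicSet) :=
    (ha.trans_le (hu x₀ hx₀).1).trans_le (le_csSup hbdd ⟨x₀, hx₀, rfl⟩)
  -- An expectation neither exceeds the supremum nor falls below the infimum; comparing at the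
  -- supremum gives `ϱ ≤ δ`, at the infimum `δ ≤ ϱ`.
  have h1 : sSup (u '' M.ergodicSet) ≤ M.δ * sSup (u '' M.ergodicSet) / ϱ := csSup_le hne' (by
    rintro _ ⟨x, hx, rfl⟩
    rw [le_div_iff₀ hϱ]
    linarith [hup x hx])
  have h2 : M.δ * sInf (u '' M.ergodicSet) / ϱ ≤ sInf (u '' M.ergodicSet) := le_csInf hne' (by
    rintro _ ⟨x, hx, rfl⟩
    rw [div_le_iff₀ hϱ]
    linarith [hdn x hx])
  rw [le_div_iff₀ hϱ] at h1
  rw [div_le_iff₀ hϱ] at h2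
  refine le_antisymm (le_of_mul_le_mul_left ?_ hs0)
    (le_of_mul_le_mul_left ?_ (ha.trans_le hlow))
  · linarith
  · linarith

/-- Bounded harmonic functions on the ergodic set are constant. -/
lemma eq_start_of_harmonic (h : M.Nonbinding) (S : M.Solution W N) {u : State n → ℝ} {a b : ℝ}
    (hu : ∀ x ∈ M.ergodicSet, a ≤ u x ∧ u x ≤ b)
    (he : ∀ x ∈ M.ergodicSet, u x = M.mean (fun r => u (M.next x r))) :
    ∀ x ∈ M.ergodicSet, u x = u (multState W 0 0) := by
  have hx₀ : multState W 0 0 ∈ M.ergodicSet := S.start_next_mem h 0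
  set u₀ := u (multState W 0 0)
  set A := (fun x => |u x - u₀|) '' M.ergodicSet with hA
  have hbdd : BddAbove A := ⟨b - a, by
    rintro _ ⟨x, hx, rfl⟩
    have h1 := hu x hx
    have h2 := hu _ hx₀
    exact abs_le.2 ⟨by linarith, by linarith⟩⟩
  have hB : ∀ x ∈ M.ergodicSet, |u x - u₀| ≤ sSup A := fun x hx => le_csSup hbdd ⟨x, hx, rfl⟩
  have hstep : ∀ x ∈ M.ergodicSet, ∀ c, |u (M.next x 0) - u₀| ≤ c →
      |u x - u₀| ≤ M.π 0 * c + (1 - M.π 0) * sSup A := fun x hx c hc => by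
    have : u x - u₀ = M.mean (fun r => u (M.next x r) - u₀) := by
      rw [mean_sub, mean_const, ← he x hx]
    rw [this]
    exact abs_mean_le hc fun r => hB _ (ergodicSet_next hx r)
  -- A run of lowest shares leads to the reference state, where the deviation is zero, and has
  -- probability `π 0 ^ (k + 1)`: one draw moves to `(0, N r θ)` and `k` more reset the multiplier.
  -- One `k` serves all states, so the supremum of the deviations contracts.
  have key : ∀ (k : ℕ) (r : Fin (n + 2)) (θ : ℝ), 0 ≤ θ → multState W r θ ∈ M.ergodicSet →
      (N 0)^[k] (N r θ) = 0 →
      |u (multState W r θ) - u₀| ≤ (1 - M.π 0 ^ (k + 1)) * sSup A := by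
    intro k
    induction k with
    | zero =>
      intro r θ hθ hx hz
      have h1 := hstep _ hx 0 (by
        rw [S.next_eq h _ _ hθ, show N r θ = 0 from hz]
        simp [u₀])
      rw [zero_add, pow_one]
      linarith
    | succ k ih =>
      intro r θ hθ hx hz
      have hx' := ergodicSet_next hx 0
      have h1 := hstep _ hx
      rw [S.next_eq h _ _ hθ] at h1 hx'
      have h2 := h1 _ (ih 0 (N r θ) (S.N_nonneg r θ hθ) hx' hz)
      rw [pow_succ (M.π 0) (k + 1)]
      linarith
  obtain ⟨K, hK⟩ := S.exists_iterate_zero h (M.cap W)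
  have hle : sSup A ≤ (1 - M.π 0 ^ (K + 1)) * sSup A := by
    refine csSup_le ⟨_, _, hx₀, rfl⟩ ?_
    rintro _ ⟨x, hx, rfl⟩
    obtain ⟨r, θ, h0, h1, rfl⟩ := S.exists_of_mem_ergodicSet h hx
    exact key K r θ h0 hx (hK _ (S.N_nonneg r θ h0) (S.N_le_cap r h1))
  have hA0 : sSup A ≤ 0 := by
    have := pow_pos (M.π_pos 0) (K + 1)
    by_contra hc
    have := mul_pos this (not_le.1 hc)
    linarith
  intro x hx
  have := (hB x hx).trans hA0
  exact sub_eq_zero.1 (abs_nonpos_iff.1 this)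

/-- Perron pairs are unique up to scaling. -/
lemma perron_unique (h : M.Nonbinding) (S : M.Solution W N) {ϱ : ℝ} {ψ : State n → ℝ}
    (hψ : M.IsPerronPair ϱ ψ) : ϱ = M.δ ∧
      ∃ C, 0 < C ∧ ∀ x ∈ M.ergodicSet, ψ x = C * (M.f x / M.nu x) := by
  obtain ⟨⟨a, b, ha, hab⟩, heig⟩ := hψ
  have hβ := M.β_pos
  have hδ := M.δ_pos
  have hx₀ : multState W 0 0 ∈ M.ergodicSet := S.start_next_mem h 0
  have hpos : ∀ {y}, y ∈ M.ergodicSet → 0 < M.f y / M.nu y := fun hy =>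
    (kernel_lower_pos W).trans_le (S.f_div_nu_bounds h hy).1
  set u : State n → ℝ := fun x => ψ x / (M.f x / M.nu x) with hu
  have hb0 : 0 ≤ b := ha.le.trans ((hab _ hx₀).1.trans (hab _ hx₀).2)
  have hub : ∀ x ∈ M.ergodicSet, a / (M.δ / (M.β + M.δ)) ≤ u x ∧
      u x ≤ b / (M.δ / ((M.β + M.δ) * Real.exp (M.cap W))) := fun x hx => by
    have h1 := hab x hx
    have h2 := S.f_div_nu_bounds h hx
    exact ⟨div_le_div₀ (ha.le.trans h1.1) h1.1 (hpos hx) h2.2,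
      div_le_div₀ hb0 h1.2 (kernel_lower_pos W) h2.1⟩
  have he : ∀ x ∈ M.ergodicSet, ϱ * u x = M.δ * M.mean (fun r => u (M.next x r)) := fun x hx => by
    rw [hu, ← S.Q_eq_mean h ψ hx, heig x hx, mul_div_assoc]
  have hϱ : ϱ = M.δ := root_eq_of_mean ⟨_, hx₀⟩ (by positivity) hub he
  refine ⟨hϱ, u (multState W 0 0), ?_, fun x hx => ?_⟩
  · exact div_pos (ha.trans_le (hab _ hx₀).1) (hpos hx₀)
  · rw [← S.eq_start_of_harmonic h hub (fun x hx => by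
      have := he x hx
      rw [hϱ] at this
      exact mul_left_cancel₀ hδ.ne' this) x hx]
    exact (div_mul_cancel₀ _ (hpos hx).ne').symm

/-! ### The largest multiplier and the Martin–Ross bound. -/

lemma tendsto_last {φ : ℝ → ℝ} (S : M.Solution W N) (hφ : ContinuousOn φ (Set.Ici 0)) :
    Tendsto (fun k => φ ((N (Fin.last (n + 1)))^[k] 0)) atTop (𝓝 (φ (M.cap W))) :=
  (hφ _ S.cap_mem.1).tendsto.comp (tendsto_nhdsWithin_iff.2
    ⟨S.tendsto_iterate_last, Eventually.of_forall fun k => (S.iterate_last_mem k).1⟩)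

lemma isLUB_nu (h : M.Nonbinding) (S : M.Solution W N) :
    IsLUB (M.nu '' M.ergodicSet) (Real.exp (M.cap W)) := by
  refine ⟨?_, fun b hb => ?_⟩
  · rintro _ ⟨x, hx, rfl⟩
    obtain ⟨r, θ, h0, h1, rfl⟩ := S.exists_of_mem_ergodicSet h hx
    rw [S.nu_eq h r h0]
    exact Real.exp_le_exp.2 (S.N_le_cap r h1)
  · have hlim := S.tendsto_last (Real.continuous_exp.comp_continuousOn
      (S.N_continuousOn (Fin.last (n + 1))))
    simp only [Function.comp_apply, S.N_last_cap] at hlim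
    refine le_of_tendsto' hlim fun k => hb ⟨_, S.iterate_last_mem_ergodicSet h k, ?_⟩
    exact S.nu_eq h _ (S.iterate_last_mem k).1

lemma kernel_continuousOn (S : M.Solution W N) (r : Fin (n + 2)) :
    ContinuousOn (M.kernel N r) (Set.Ici 0) :=
  continuousOn_const.div ((by fun_prop : Continuous fun θ => M.β * Real.exp θ).continuousOn.add
    (continuousOn_const.mul (Real.continuous_exp.comp_continuousOn (S.N_continuousOn r))))
    fun θ _ => (kernel_den_pos N r θ).ne'

lemma martinRoss_eq (h : M.Nonbinding) (S : M.Solution W N) {ψ : State n → ℝ} {C : ℝ}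
    (hC : 0 < C) (hψ : ∀ x ∈ M.ergodicSet, ψ x = C * (M.f x / M.nu x)) :
    M.martinRoss ψ = M.cap W := by
  have hβ := M.β_pos
  have hδ := M.δ_pos
  have hne : (ψ '' M.ergodicSet).Nonempty := ⟨_, _, S.start_next_mem h 0, rfl⟩
  have h1 : IsLUB (ψ '' M.ergodicSet) (C * (M.δ / (M.β + M.δ))) := by
    refine IsGreatest.isLUB ⟨⟨_, S.start_next_mem h 0, ?_⟩, ?_⟩
    · rw [hψ _ (S.start_next_mem h 0), S.f_div_nu h 0 le_rfl, S.kernel_start h]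
    · rintro _ ⟨x, hx, rfl⟩
      rw [hψ x hx]
      exact mul_le_mul_of_nonneg_left (S.f_div_nu_bounds h hx).2 hC.le
  have h2 : IsGLB (ψ '' M.ergodicSet) (C * (M.δ / ((M.β + M.δ) * Real.exp (M.cap W)))) := by
    refine ⟨?_, fun b hb => ?_⟩
    · rintro _ ⟨x, hx, rfl⟩
      rw [hψ x hx]
      exact mul_le_mul_of_nonneg_left (S.f_div_nu_bounds h hx).1 hC.le
    -- The infimum need not be attained on the ergodic set; it is approached along a run of highest
    -- shares.
    · have hlim := S.tendsto_last (continuousOn_const (c := C) |>.mul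
        (S.kernel_continuousOn (Fin.last (n + 1))))
      rw [← S.kernel_last]
      refine ge_of_tendsto' hlim fun k => hb ⟨_, S.iterate_last_mem_ergodicSet h k, ?_⟩
      rw [hψ _ (S.iterate_last_mem_ergodicSet h k), S.f_div_nu h _ (S.iterate_last_mem k).1]
      rfl
  rw [martinRoss, h1.csSup_eq hne, h2.csInf_eq hne]
  have : C * (M.δ / (M.β + M.δ)) / (C * (M.δ / ((M.β + M.δ) * Real.exp (M.cap W)))) =
      Real.exp (M.cap W) := by
    field_simp
  rw [this, Real.log_exp]

/-- Where the multiplier stays constant, consumption is `young 0`, so the debt is the first-best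
one. -/
lemma atDebt_eq (S : M.Solution W N) {i : Fin (n + 2)} {θ : ℝ} (hθ : 0 ≤ θ)
    (hi : M.cstar i = M.young 0) (hN : N i θ = θ) :
    M.atDebt i (M.dstar i) = multState W i θ := by
  rw [atDebt, dstar, hi, promise_debt, multState, S.W_eq i θ hθ, hN, sub_self]

lemma yield_le (h : M.Nonbinding) (S : M.Solution W N) {k : ℕ} {r : Fin (n + 2)} {θ θ' : ℝ}
    (hθ : 0 ≤ θ) (hle : θ ≤ θ') : M.yield k (multState W r θ) ≤ M.yield k (multState W r θ') := by
  have h1 := Real.log_le_log (S.price_pos h k r (hθ.trans hle)) (S.price_antitone h k r hθ hle)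
  have h2 := mul_le_mul_of_nonneg_left h1 (by positivity : 0 ≤ 1 / (k : ℝ))
  unfold yield
  linarith

lemma debt_le_iff (h : M.Nonbinding) (S : M.Solution W N) {r : Fin (n + 2)} {θ θ' : ℝ}
    (hθ : 0 ≤ θ) (hθ' : 0 ≤ θ') :
    M.debt (multState W r θ) ≤ M.debt (multState W r θ') ↔ θ ≤ θ' := by
  rw [← S.W_le_iff h r hθ hθ', debt, debt]
  simp only [multState]
  rw [div_le_div_iff_of_pos_right (M.s_pos _), sub_le_sub_iff_right, Real.exp_le_exp]

end Solution

end

end Economy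

end OLG

end

/-! ### The proposition. -/

theorem proposition6 {n J : ℕ} (M : OLG.Economy n J)
    -- the trace of the autarkic state-price matrix exceeds the average growth rate
    (hsustain : M.gbar < ∑ i, M.π i * (M.β * M.s i / (1 - M.s i)))
    (hlow : M.s 0 ≤ M.δ / (M.β + M.δ))
    -- the first best is not sustainable
    (hnofb : Real.log (M.cstar (Fin.last (n + 1))) +
        M.β * ∑ r, M.π r * Real.log (1 - M.cstar r) < M.autarky (Fin.last (n + 1)))
    -- the bounds on debt do not bind
    (hnonneg : ∀ i, M.δ / (M.β + M.δ) ≤ M.s i)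
    (hlimit : M.dstar (Fin.last (n + 1)) < M.dmax) :
    -- the states in (iv) and (v) are in the (closed) ergodic set
    (M.atDebt 0 (M.dstar 0) ∈ M.ergodicSet ∧
      M.atDebt (Fin.last (n + 1)) (M.dstar (Fin.last (n + 1))) ∈ closure M.ergodicSet) ∧
    -- (i)
    (∀ x ∈ closure M.ergodicSet, ∀ e : ℝ, 0 < e → ∀ k : ℕ, 1 ≤ k →
      M.yieldPlus k (x, e) = M.yield k x + Real.log M.gbar) ∧
    -- (ii)
    (∀ x ∈ closure M.ergodicSet,
      Tendsto (fun k => M.yield k x) atTop (𝓝 (-Real.log M.δ)) ∧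
      ∀ e : ℝ, 0 < e → Tendsto (fun k => M.yieldPlus k (x, e)) atTop
        (𝓝 (-Real.log M.δ + Real.log M.gbar))) ∧
    -- (iii)
    (∀ k : ℕ, 1 ≤ k → ∀ x ∈ closure M.ergodicSet, ∀ x' ∈ closure M.ergodicSet,
      x.1 = x'.1 → M.debt x ≤ M.debt x' → M.yield k x ≤ M.yield k x') ∧
    -- (iv)
    (0 < -Real.log M.δ - M.yield 1 (M.atDebt 0 (M.dstar 0)) ∧
      -Real.log M.δ - M.yield 1 (M.atDebt (Fin.last (n + 1)) (M.dstar (Fin.last (n + 1)))) < 0) ∧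
    -- (v)
    (IsLUB (M.nu '' M.ergodicSet)
        (M.nu (M.atDebt (Fin.last (n + 1)) (M.dstar (Fin.last (n + 1))))) ∧
      (∃ ϱ ψ, M.IsPerronPair ϱ ψ) ∧
      ∀ ϱ ψ, M.IsPerronPair ϱ ψ → ϱ = M.δ ∧
        M.martinRoss ψ =
          Real.log (M.nu (M.atDebt (Fin.last (n + 1)) (M.dstar (Fin.last (n + 1)))))) := by
  have hcs : ∀ i, M.cstar i = M.young 0 := fun i => by
    rw [OLG.Economy.cstar, min_eq_left (hnonneg i), M.young_zero]
  have hN : M.Nonbinding :=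
    { s_zero := (le_antisymm hlow (hnonneg 0)).trans M.young_zero.symm
      no_first_best := by
        have e : ∑ r, M.π r * Real.log (1 - M.cstar r) = M.oldU 0 := by
          simp only [hcs]
          exact M.mean_const _
        rwa [e, hcs] at hnofb
      limit := by rwa [OLG.Economy.dstar, hcs] at hlimit }
  obtain ⟨W, N, S⟩ := OLG.Economy.exists_solution hN
  rw [S.atDebt_eq le_rfl (hcs 0) (S.zero_zero hN),
    S.atDebt_eq S.cap_mem.1 (hcs _) S.N_last_cap, S.nu_eq hN _ S.cap_mem.1, S.N_last_cap]
  have hplus : ∀ x ∈ closure M.ergodicSet, ∀ e : ℝ, 0 < e → ∀ k : ℕ, 1 ≤ k →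
      M.yieldPlus k (x, e) = M.yield k x + Real.log M.gbar := by
    intro x hx e he k hk
    obtain ⟨r, θ, h0, -, rfl⟩ := S.exists_of_mem_closure hN hx
    exact OLG.Economy.yieldPlus_eq he hk (S.price_pos hN k r h0)
  have hlim : ∀ x ∈ closure M.ergodicSet,
      Tendsto (fun k => M.yield k x) atTop (𝓝 (-Real.log M.δ)) := by
    intro x hx
    obtain ⟨r, θ, h0, h1, rfl⟩ := S.exists_of_mem_closure hN hx
    exact S.tendsto_yield hN r h0 h1
  have hyield : ∀ x, M.yield 1 x = -Real.log (M.price 1 x) := fun x => by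
    simp [OLG.Economy.yield]
  refine ⟨⟨S.start_next_mem hN 0, S.last_mem_closure hN⟩, hplus,
    fun x hx => ⟨hlim x hx, fun e he => ?_⟩, ?_, ⟨?_, ?_⟩, S.isLUB_nu hN,
    ⟨_, _, S.isPerronPair hN⟩, fun ϱ ψ hψ => ?_⟩
  · refine ((hlim x hx).add_const _).congr' ?_
    filter_upwards [eventually_ge_atTop 1] with k hk
    exact (hplus x hx e he k hk).symm
  · intro k _ x hx x' hx' hxx' hd
    obtain ⟨r, θ, h0, -, rfl⟩ := S.exists_of_mem_closure hN hx
    obtain ⟨r', θ', h0', -, rfl⟩ := S.exists_of_mem_closure hN hx'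
    obtain rfl : r = r' := hxx'
    exact S.yield_le hN h0 ((S.debt_le_iff hN h0 h0').1 hd)
  · rw [hyield]
    linarith [Real.log_lt_log M.δ_pos (S.lt_price_one_start hN)]
  · rw [hyield]
    linarith [Real.log_lt_log (S.price_pos hN 1 _ S.cap_mem.1) (S.price_one_last_lt hN)]
  · obtain ⟨h1, C, hC, h2⟩ := S.perron_unique hN hψ
    exact ⟨h1, by rw [S.martinRoss_eq hN hC h2, Real.log_exp]⟩
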